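/- Let $m\in\{2,3\}$, $n\ge 2$, and let $\mathbb G$ be an undirected graph on $\{1,\dots,n\}$ with edges $\mathcal E_1,\dots,\mathcal E_r$, each ordered as $\mathcal E_k=(\mathrm{tail}_k,\mathrm{head}_k)$. For $p=(p_1,\dots,p_n)$ with $p_i\in\mathbb R^m$ put $z_k=p_{\mathrm{tail}_k}-p_{\mathrm{head}_k}$. Let $B=(b_{ik})$ be the incidence matrix ($+1$ at the tail, $-1$ at the head, $0$ elsewhere) and $S_1=(s_{ik})$ the matrix obtained from $B$ by replacing each $-1$ by $0$. The framework $(\mathbb G,p)$ is infinitesimally rigid if its rigidity matrix, with entries $R_{k,(i,a)}=b_{ik}(z_k)_a$, has rank $mn-m(m+1)/2$ (that is, $2n-3$ if $m=2$ and $3n-6$ if $m=3$); it is infinitesimally and minimally rigid if in addition $r=mn-m(m+1)/2$. Let $(\mathbb G,p^{d})$ be an infinitesimally and minimally rigid desired framework, with relative positions $z^{d}_k$, and let $e_k=\|z_k\|^2-\|z^{d}_k\|^2$ be the distance errors, $e=(e_1,\dots,e_r)$. For $\mu\in\mathbb R^r$ consider the double-integrator agents under the mismatched gradient controller with damping, $$\dot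 p_i=v_i,\qquad \dot v_i=-v_i-\sum_{k} b_{ik}\,e_k z_k-\sum_{k} s_{ik}\,\mu_k z_k ,\qquad i=1,\dots,n.$$ Then there is $\rho>0$ such that for every $\varepsilon_2>0$ there is $\varepsilon_1>0$ with the following property. For every $\mu$ with $\|\mu\|\le\varepsilon_1$ there is $e^*\in\mathbb R^r$ with $\|e^*\|\le\varepsilon_2$ such that, for every initial state $(p(0),v(0))$ with $\|z_k(0)-Qz^{d}_k\|\le\rho$ for all $k$, for some rotation $Q\in SO(m)$, and $\|v_i(0)\|\le\rho$ for all $i$, a solution exists on $[0,\infty)$, and every solution on $[0,\infty)$ satisfies: (1) $e(t)\to e^*$ as $t\to\infty$; (2) the steady-state shape is a framework $(\mathbb G,b)$, $b=(b_1,\dots,b_n)$, $\sum_i b_i=0$, that is still infinitesimally and minimally rigid and is distorted by $e^*$, i.e. its edge lengths satisfy $\|b_{\mathrm{tail}_k}-b_{\mathrm{head}_k}\|^2=\|z^{d}_k\|^2+e^*_k$; (3) there are a constant angular velocity (a skew-symmetric $m\times m$ matrix $\Omega$) and a constant translational velocity $v_c\in\mathbb R^m$, both expressed in a body frame placed at the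 centroid of this shape, and a rigid motion $p_i^*(t)=c(t)+Q(t)b_i$ with $Q(t)\in SO(m)$, $\dot Q=Q\Omega$, $\dot c=Qv_c$, whose velocities are $v_i^*(t)=Q(t)(v_c+\Omega b_i)$, such that, as $t\to\infty$, $v_i(t)-v_i^*(t)\to0$ for all $i$ and $(p_i(t)-p_j(t))-(p_i^*(t)-p_j^*(t))\to0$ for all $i,j$. -/

import Mathlib

open Filter Topology Set
open scoped Matrix

noncomputable section

namespace Formation

/-- The physical space `ℝ^m` with its Euclidean norm. -/
abbrev Space (m : ℕ) : Type := EuclideanSpace ℝ (Fin m)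

/-- A finite simple undirected sensing graph on the agents `Fin n`, with edges numbered by `Fin r`,
and each edge ordered as `(tail, head)`. No loops, and every undirected edge is listed once. -/
structure SensingGraph (n r : ℕ) where
  tail : Fin r → Fin n
  head : Fin r → Fin n
  tail_ne_head : ∀ k, tail k ≠ head k
  edge_injective : Function.Injective (fun k => s(tail k, head k))

variable {m n r : ℕ}

/-- The incidence matrix `B`: `+1` at the tail, `-1` at the head, `0` elsewhere. -/
def SensingGraph.incidence (G : SensingGraph n r) : Matrix (Fin n) (Fin r) ℝ :=
  fun i k => if i = G.tail k then 1 else if i = G.head k then -1 else 0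

/-- The matrix `S₁`: the incidence matrix with its `-1` entries replaced by `0`. -/
def SensingGraph.tailIncidence (G : SensingGraph n r) : Matrix (Fin n) (Fin r) ℝ :=
  fun i k => if i = G.tail k then 1 else 0

/-- The relative position `z_k = p_tail - p_head` along the edge `k`. -/
def relPos (G : SensingGraph n r) (p : Fin n → Space m) (k : Fin r) : Space m :=
  p (G.tail k) - p (G.head k)

/-- The rigidity matrix `R(z) = D_zᵀ (B ⊗ I_m)ᵀ`, with entries `R_{k,(i,a)} = b_{ik} (z_k)_a`. -/
def rigidityMatrix (G : SensingGraph n r) (p : Fin n → Space m) :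
    Matrix (Fin r) (Fin n × Fin m) ℝ :=
  fun k ia => G.incidence ia.1 k * relPos G p k ia.2

/-- Infinitesimal rigidity: the rigidity matrix has rank `m n - m (m + 1) / 2`, that is, `2n - 3`
in the plane and `3n - 6` in space. -/
def InfinitesimallyRigid (G : SensingGraph n r) (p : Fin n → Space m) : Prop :=
  (rigidityMatrix G p).rank + m * (m + 1) / 2 = m * n

/-- Infinitesimal and minimal rigidity: infinitesimal rigidity with exactly `m n - m (m + 1) / 2`
edges. -/
def InfMinRigid (G : SensingGraph n r) (p : Fin n → Space m) : Prop :=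
  InfinitesimallyRigid G p ∧ r + m * (m + 1) / 2 = m * n

/-- The distance errors `e_k = ‖z_k‖² - d_k²`, where `d_k` is the length of the edge `k` in the
desired framework `pd`. -/
def distError (G : SensingGraph n r) (pd p : Fin n → Space m) : EuclideanSpace ℝ (Fin r) :=
  WithLp.toLp 2 fun k => ‖relPos G p k‖ ^ 2 - ‖relPos G pd k‖ ^ 2

/-- The mismatched control input `u = -v - (B ⊗ I) D_z e - (S₁ ⊗ I) D_z μ`, agent by agent. -/
def control (G : SensingGraph n r) (pd : Fin n → Space m) (μ : EuclideanSpace ℝ (Fin r))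
    (p v : Fin n → Space m) : Fin n → Space m :=
  fun i => - v i - ∑ k, (G.incidence i k * distError G pd p k) • relPos G p k
    - ∑ k, (G.tailIncidence i k * μ k) • relPos G p k

/-- `(p, v)` is a solution on `[0, ∞)` of the closed loop `p' = v`, `v' = u`. -/
structure IsSolution (G : SensingGraph n r) (pd : Fin n → Space m) (μ : EuclideanSpace ℝ (Fin r))
    (p v : ℝ → Fin n → Space m) : Prop where
  pos : ∀ t, 0 ≤ t → HasDerivWithinAt p (v t) (Ici 0) t
  vel : ∀ t, 0 ≤ t → HasDerivWithinAt v (control G pd μ (p t) (v t)) (Ici 0) t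

/-- The action `A x` of an `m × m` matrix on a vector. -/
def act (A : Matrix (Fin m) (Fin m) ℝ) (x : Space m) : Space m :=
  WithLp.toLp 2 (A *ᵥ WithLp.ofLp x)

/-- The positions `p` and velocities `v` of the agents perform a steady rigid motion. In the body
frame, whose origin is the centroid `c t` of the moving framework and whose orientation with
respect to the global frame is the rotation `Q t`, the agents have the constant positions `b i`
(with `∑ b i = 0`), and the framework has the constant translational velocity `vc` and the
constant angular velocity `Ω`. Angular velocities are written as skew-symmetric matrices: for
`m = 3` the matrix `Ω` is `x ↦ ω × x`, for `m = 2` it is the rotation by a right angle times the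
scalar angular velocity. -/
def IsSteadyMotion (b : Fin n → Space m) (Ω : Matrix (Fin m) (Fin m) ℝ) (vc : Space m)
    (p v : ℝ → Fin n → Space m) : Prop :=
  ∑ i, b i = 0 ∧ Ωᵀ = -Ω ∧
  ∃ (Q : ℝ → Matrix (Fin m) (Fin m) ℝ) (c : ℝ → Space m), ∀ t,
    Q t ∈ Matrix.specialOrthogonalGroup (Fin m) ℝ ∧
    (∀ i j, HasDerivAt (fun τ => Q τ i j) ((Q t * Ω) i j) t) ∧
    HasDerivAt c (act (Q t) vc) t ∧
    ∀ i, p t i = c t + act (Q t) (b i) ∧ v t i = act (Q t) (vc + act Ω (b i))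

/-- The initial state `(p, v)` is `ρ`-close to a desired one at rest: the relative positions are
`ρ`-close to those of a rotated copy of the desired framework `pd`, the speeds are at most `ρ`. -/
def NearDesired (G : SensingGraph n r) (pd : Fin n → Space m) (ρ : ℝ)
    (p v : Fin n → Space m) : Prop :=
  (∃ Q ∈ Matrix.specialOrthogonalGroup (Fin m) ℝ,
    ∀ k, ‖relPos G p k - act Q (relPos G pd k)‖ ≤ ρ) ∧ ∀ i, ‖v i‖ ≤ ρ

end Formation

end

/-! Modulo rotations and translations the closed loop is an autonomous system for which the desired
shape at rest is a hyperbolic sink. The sink persists for small `μ`, and its lift to physical space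
is a steady rigid motion.

Write `R` for the rigidity matrix at `pd`. Minimal rigidity says that `R` has full row rank, and
then (if there is an edge) translations, infinitesimal rotations and the range of `Rᵀ` together
decompose every velocity uniquely (`velocityMap_bijective`). So the slice `pd + Rᵀ y`, `y ∈ ℝ^r`, is
transverse to the rigid motions, and a best-fit rotation brings every nearby framework to the form
`p i = c + Q b i` with `b` in the slice (`exists_slice_representation`). Put `v i = Q w i` and split
`w = a + ω b + Rᵀ η`. Since the forces are equivariant, `(y, w)` obeys equations free of `c` and
`Q`: `y' = η`, `w' = -w - ω w - forces` (`reducedField`).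

For `μ = 0` the linearization at the origin is `y' = η` with `R Rᵀ η = R w`, and `w' = -w - Rᵀ N y`
with `N = 2 R Rᵀ`. The form `½|N y|² + |w|² + δ ⟨N y, R w⟩` with small `δ` is a strict Lyapunov
function (`exists_lyapunov`). For small `μ` the nonlinear field still contracts in this form, has an
equilibrium near `0`, and attracts a ball of fixed radius exponentially
(`exists_stable_equilibria`).

At an equilibrium `η = 0`, so `w = a + ω b` is a constant rigid velocity in the body frame. The
exponential rate makes the error in the angular velocity integrable, which fixes the phase of the
limiting rotation (`exists_asymptotic_frame`); `exists_solution_of_reduced` assembles the physical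
solution, and uniqueness transfers its behaviour to all solutions. -/

namespace FormationProof

open Formation
open scoped NNReal

/-! ### Global existence and uniqueness for ordinary differential equations. -/

section ODE

variable {E : Type*} [NormedAddCommGroup E] [NormedSpace ℝ E]

/-- The radial retraction of a normed space onto the closed ball of radius `M`. -/
noncomputable def radialRetraction (M : ℝ) (x : E) : E := (M / max M ‖x‖) • x

theorem radialRetraction_of_norm_le {M : ℝ} (hM : 0 < M) {x : E} (hx : ‖x‖ ≤ M) :
    radialRetraction M x = x := by
  simp [radialRetraction, max_eq_left hx, hM.ne']

theorem norm_radialRetraction_le {M : ℝ} (hM : 0 < M) (x : E) : ‖radialRetraction M x‖ ≤ M := by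
  have h : 0 < max M ‖x‖ := lt_max_of_lt_left hM
  rw [radialRetraction, norm_smul, Real.norm_of_nonneg (by positivity), div_mul_eq_mul_div,
    div_le_iff₀ h]
  exact mul_le_mul_of_nonneg_left (le_max_right _ _) hM.le

/-- Moving the point and changing the scaling factor each cost at most `‖x - y‖`, whence the
constant `2` in an arbitrary norm. -/
theorem lipschitzWith_radialRetraction {M : ℝ} (hM : 0 < M) :
    LipschitzWith 2 (radialRetraction M : E → E) := by
  refine LipschitzWith.of_dist_le_mul fun x y => ?_
  rw [dist_eq_norm, dist_eq_norm]
  have hα : 0 < max M ‖x‖ := lt_max_of_lt_left hM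
  have hβ : 0 < max M ‖y‖ := lt_max_of_lt_left hM
  set α := max M ‖x‖ with hα'
  set β := max M ‖y‖ with hβ'
  have h1 : radialRetraction M x - radialRetraction M y
      = (M / α) • (x - y) + (M / α - M / β) • y := by
    simp only [radialRetraction, ← hα', ← hβ']
    module
  have h2 : |β - α| ≤ ‖x - y‖ := by
    have := abs_max_sub_max_le_abs ‖y‖ ‖x‖ M
    rw [max_comm _ M, max_comm _ M] at this
    exact this.trans ((abs_norm_sub_norm_le y x).trans (norm_sub_rev y x).le)
  have h3 : ‖(M / α) • (x - y)‖ ≤ ‖x - y‖ := by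
    rw [norm_smul, Real.norm_of_nonneg (by positivity)]
    exact mul_le_of_le_one_left (norm_nonneg _) ((div_le_one hα).2 (le_max_left _ _))
  have h4 : ‖(M / α - M / β) • y‖ ≤ |β - α| := by
    have : M / α - M / β = (M / α) * ((β - α) / β) := by field_simp
    rw [norm_smul, this, norm_mul, norm_div, norm_div, Real.norm_of_nonneg hM.le,
      Real.norm_of_nonneg hα.le, Real.norm_of_nonneg hβ.le, Real.norm_eq_abs]
    have a1 : M / α ≤ 1 := (div_le_one hα).2 (le_max_left _ _)
    have a2 : ‖y‖ / β ≤ 1 := (div_le_one hβ).2 (le_max_right _ _)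
    calc M / α * (|β - α| / β) * ‖y‖ = (M / α) * (|β - α| * (‖y‖ / β)) := by ring
      _ ≤ 1 * (|β - α| * 1) := by gcongr
      _ = _ := by ring
  rw [h1]
  calc _ ≤ ‖x - y‖ + ‖x - y‖ := (norm_add_le _ _).trans (add_le_add h3 (h4.trans h2))
    _ = _ := by push_cast; ring

/-- Global existence for a vector field which, locally uniformly in time, is bounded and Lipschitz
on the whole space. -/
theorem exists_global_solution [CompleteSpace E] {f : ℝ → E → E}
    (hf : ∀ T : ℝ, ∃ K L : ℝ≥0, ∀ t, |t| ≤ T → LipschitzWith K (f t) ∧ ∀ x, ‖f t x‖ ≤ L)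
    (hc : ∀ x, Continuous fun t => f t x) (x₀ : E) :
    ∃ α : ℝ → E, α 0 = x₀ ∧ ∀ t, HasDerivAt α (f t (α t)) t := by
  have key : ∀ N : ℕ, ∃ α : ℝ → E, α 0 = x₀ ∧ ∀ t ∈ Icc (-(N + 1 : ℝ)) (N + 1),
      HasDerivWithinAt α (f t (α t)) (Icc (-(N + 1 : ℝ)) (N + 1)) t := by
    intro N
    obtain ⟨K, L, h⟩ := hf (N + 1)
    have h0 : (0 : ℝ) ∈ Icc (-(N + 1 : ℝ)) (N + 1) := ⟨by linarith [N.cast_nonneg (α := ℝ)],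
      by positivity⟩
    -- The bound `L` holds on the whole space, so the ball can be given the radius `L (N + 1)` that
    -- the time interval demands.
    have hPL : IsPicardLindelof f (⟨0, h0⟩ : Icc (-(N + 1 : ℝ)) (N + 1)) x₀
        (L * (N + 1 : ℝ≥0)) 0 L K :=
      { lipschitzOnWith := fun t ht => (h t (abs_le.2 ht)).1.lipschitzOnWith
        continuousOn := fun x _ => (hc x).continuousOn
        norm_le := fun t ht x _ => (h t (abs_le.2 ht)).2 x
        mul_max_le := by simp }
    exact hPL.exists_eq_forall_mem_Icc_hasDerivWithinAt₀
  choose α hα0 hα using key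
  have hd : ∀ N : ℕ, ∀ t ∈ Ioo (-(N + 1 : ℝ)) (N + 1), HasDerivAt (α N) (f t (α N t)) t :=
    fun N t ht => (hα N t (Ioo_subset_Icc_self ht)).hasDerivAt (Icc_mem_nhds ht.1 ht.2)
  have hu : ∀ N M : ℕ, N ≤ M → ∀ t : ℝ, |t| ≤ N → α N t = α M t := by
    intro N M hNM t ht
    obtain ⟨K, L, h⟩ := hf (N + 1)
    have hNM' : (N : ℝ) ≤ M := by exact_mod_cast hNM
    have hN0 := N.cast_nonneg (α := ℝ)
    have hsub : Icc (-(N + 1 : ℝ)) (N + 1) ⊆ Icc (-(M + 1 : ℝ)) (M + 1) :=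
      Icc_subset_Icc (by linarith) (by linarith)
    refine ODE_solution_unique_of_mem_Icc (v := f) (s := fun _ => univ) (K := K) (t₀ := 0)
      (a := -(N + 1 : ℝ)) (b := N + 1)
      (fun s hs => (h s (abs_le.2 ⟨hs.1.le, hs.2.le⟩)).1.lipschitzOnWith)
      ⟨by linarith, by linarith⟩
      (fun s hs => (hα N s hs).continuousWithinAt) (hd N) (fun _ _ => mem_univ _)
      (fun s hs => ((hα M s (hsub hs)).continuousWithinAt).mono hsub)
      (fun s hs => hd M s ⟨by linarith [hs.1], by linarith [hs.2]⟩) (fun _ _ => mem_univ _)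
      ((hα0 N).trans (hα0 M).symm) ?_
    rw [abs_le] at ht
    exact ⟨by linarith, by linarith⟩
  refine ⟨fun t => α ⌈|t|⌉₊ t, by simpa using hα0 _, fun t => ?_⟩
  -- One more than the ceiling, so that `|s| < N` for all `s` near `t`; there the glued function
  -- coincides with `α N`.
  set N := ⌈|t|⌉₊ + 1 with hN
  have ht : |t| < N := by
    have := Nat.le_ceil |t|
    rw [hN]; push_cast; linarith
  have hev : (fun s => α ⌈|s|⌉₊ s) =ᶠ[𝓝 t] α N := by
    filter_upwards [(continuous_abs.tendsto t).eventually (eventually_lt_nhds ht)] with s hs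
    exact hu _ _ (Nat.ceil_le.2 hs.le) s (Nat.le_ceil _)
  change HasDerivAt _ (f t (α ⌈|t|⌉₊ t)) t
  rw [show α ⌈|t|⌉₊ t = α N t from hev.eq_of_nhds]
  rw [abs_lt] at ht
  exact (hd N t ⟨by linarith, by linarith⟩).congr_of_eventuallyEq hev

/-- Two solutions on `[0, ∞)` of a `C¹` autonomous equation with the same initial value agree. -/
theorem solution_unique [FiniteDimensional ℝ E] {f : E → E} (hf : ContDiff ℝ 1 f) {α β : ℝ → E}
    (hα : ∀ t, 0 ≤ t → HasDerivWithinAt α (f (α t)) (Ici 0) t)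
    (hβ : ∀ t, 0 ≤ t → HasDerivWithinAt β (f (β t)) (Ici 0) t) (h0 : α 0 = β 0) :
    ∀ t, 0 ≤ t → α t = β t := by
  intro T hT
  have hαc : ContinuousOn α (Icc 0 T) := fun s hs =>
    (hα s hs.1).continuousWithinAt.mono Icc_subset_Ici_self
  have hβc : ContinuousOn β (Icc 0 T) := fun s hs =>
    (hβ s hs.1).continuousWithinAt.mono Icc_subset_Ici_self
  obtain ⟨R, hR⟩ := ((isCompact_Icc.image_of_continuousOn hαc).union
    (isCompact_Icc.image_of_continuousOn hβc)).isBounded.subset_closedBall (0 : E)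
  obtain ⟨K, hK⟩ := hf.locallyLipschitz.locallyLipschitzOn.exists_lipschitzOnWith_of_compact
    (isCompact_closedBall (0 : E) R)
  refine ODE_solution_unique_of_mem_Icc_right (v := fun _ => f)
    (s := fun _ => Metric.closedBall (0 : E) R) (K := K) (fun _ _ => hK) hαc
    (fun s hs => (hα s hs.1).mono (Ici_subset_Ici.2 hs.1))
    (fun s hs => hR (.inl ⟨s, Ico_subset_Icc_self hs, rfl⟩)) hβc
    (fun s hs => (hβ s hs.1).mono (Ici_subset_Ici.2 hs.1))
    (fun s hs => hR (.inr ⟨s, Ico_subset_Icc_self hs, rfl⟩)) h0 ⟨hT, le_rfl⟩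

end ODE

/-! ### Quadratic Lyapunov functions and persistence of sinks. -/

section Stability

theorem le_of_sq_le_sq_of_nonneg {a b : ℝ} (h : a ^ 2 ≤ b ^ 2) (hb : 0 ≤ b) : a ≤ b :=
  abs_le_of_sq_le_sq' h hb |>.2

variable {X P : Type*} [NormedAddCommGroup X] [NormedSpace ℝ X] [FiniteDimensional ℝ X]
  [NormedAddCommGroup P] [NormedSpace ℝ P]

/-- A positive continuous function, homogeneous of degree two, dominates a multiple of the squared
norm. -/
theorem exists_mul_sq_norm_le {q : X → ℝ} (hq : Continuous q)
    (hh : ∀ (t : ℝ) x, q (t • x) = t ^ 2 * q x) (hpos : ∀ x, x ≠ 0 → 0 < q x) :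
    ∃ c, 0 < c ∧ ∀ x, c * ‖x‖ ^ 2 ≤ q x := by
  have h0 : q 0 = 0 := by simpa using hh 0 0
  rcases subsingleton_or_nontrivial X with hX | hX
  · exact ⟨1, one_pos, fun x => by simp [Subsingleton.elim x 0, h0]⟩
  obtain ⟨u, hu, hmin⟩ := (isCompact_sphere (0 : X) 1).exists_isMinOn
    (NormedSpace.sphere_nonempty.2 zero_le_one) hq.continuousOn
  have hu0 : u ≠ 0 := by
    rintro rfl
    simp at hu
  refine ⟨q u, hpos u hu0, fun x => ?_⟩
  by_cases hx : x = 0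
  · simp [hx, h0]
  have hx' : ‖x‖ ≠ 0 := norm_ne_zero_iff.2 hx
  have h1 : q u ≤ q (‖x‖⁻¹ • x) := hmin (by simp [norm_smul, hx'])
  have h2 : q x = ‖x‖ ^ 2 * q (‖x‖⁻¹ • x) := by
    rw [← hh, smul_smul, mul_inv_cancel₀ hx', one_smul]
  rw [h2, mul_comm]
  exact mul_le_mul_of_nonneg_left h1 (sq_nonneg _)

/-- The product `exp (c t) * φ t` is nonincreasing. -/
theorem exp_decay_of_deriv_le {φ φ' : ℝ → ℝ} {c : ℝ} (hφ : ∀ t, 0 ≤ t → HasDerivAt φ (φ' t) t)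
    (hle : ∀ t, 0 ≤ t → φ' t ≤ -c * φ t) {t : ℝ} (ht : 0 ≤ t) :
    φ t ≤ φ 0 * Real.exp (-c * t) := by
  have hd : ∀ s, 0 ≤ s → HasDerivAt (fun s => Real.exp (c * s) * φ s)
      (Real.exp (c * s) * c * φ s + Real.exp (c * s) * φ' s) s := fun s hs => by
    have h1 : HasDerivAt (fun s => Real.exp (c * s)) (Real.exp (c * s) * c) s := by
      simpa using ((hasDerivAt_id s).const_mul c).exp
    exact h1.mul (hφ s hs)
  have hanti : AntitoneOn (fun s => Real.exp (c * s) * φ s) (Ici 0) := by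
    refine antitoneOn_of_hasDerivWithinAt_nonpos (convex_Ici 0)
      (fun s hs => (hd s hs).continuousAt.continuousWithinAt)
      (fun s hs => (hd s (interior_subset hs)).hasDerivWithinAt) (fun s hs => ?_)
    have := hle s (interior_subset hs)
    have h := mul_le_mul_of_nonneg_left this (Real.exp_pos (c * s)).le
    nlinarith
  have h := hanti (mem_Ici.2 le_rfl) (mem_Ici.2 ht) ht
  simp only [mul_zero, Real.exp_zero, one_mul] at h
  rw [neg_mul, Real.exp_neg, ← div_eq_mul_inv, le_div_iff₀ (Real.exp_pos _), mul_comm]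
  exact h

/-- A vector field which is contracting on a ball with respect to a positive definite bilinear form
and vanishes near the centre: solutions that start near the centre stay in the ball and converge
exponentially. -/
theorem exists_solution_of_contracting {g : X → X} {B : X →L[ℝ] X →L[ℝ] ℝ} {K : ℝ≥0}
    {r ρ c β l : ℝ} (hr : 0 < r) (hc : 0 < c) (hl : 0 < l)
    (hK : LipschitzOnWith K g (Metric.closedBall 0 r))
    (hB : ∀ h, c * ‖h‖ ^ 2 ≤ B h h) (hB' : ∀ h, B h h ≤ β * ‖h‖ ^ 2)
    (hg : ∀ x y, ‖x‖ ≤ r → ‖y‖ ≤ r →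
      B (g x - g y) (x - y) + B (x - y) (g x - g y) ≤ -(2 * l) * B (x - y) (x - y))
    (hρ : ρ ≤ r / 2) (hβρ : 4 * β * ρ ^ 2 < c * r ^ 2 / 4)
    {xe x₀ : X} (hxe : ‖xe‖ ≤ ρ) (hgxe : g xe = 0) (hx₀ : ‖x₀‖ ≤ ρ) :
    ∃ x : ℝ → X, x 0 = x₀ ∧ ∀ t, 0 ≤ t →
      HasDerivAt x (g (x t)) t ∧ ‖x t‖ ≤ r ∧ ‖x t - xe‖ ≤ r * Real.exp (-l * t) := by
  have hβ : 0 ≤ β ∨ Subsingleton X := by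
    rcases subsingleton_or_nontrivial X with h | h
    · exact .inr h
    · left
      obtain ⟨u, hu⟩ := exists_ne (0 : X)
      have := (hB u).trans (hB' u)
      have hu' : 0 < ‖u‖ ^ 2 := by positivity
      exact (lt_of_lt_of_le hc (le_of_mul_le_mul_right this hu')).le
  -- The cut-off gives a global solution; it is then shown to stay in the ball, where the cut-off
  -- field is `g`.
  let f : ℝ → X → X := fun _ x => g (radialRetraction r x)
  have hmem : ∀ x : X, radialRetraction r x ∈ Metric.closedBall (0 : X) r := fun x => by
    simpa using norm_radialRetraction_le hr x
  obtain ⟨x, hx0, hx⟩ := exists_global_solution (f := f) (fun T => by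
    refine ⟨K * 2, K * (2 * r.toNNReal) + ‖g 0‖₊, fun t _ => ⟨?_, fun x => ?_⟩⟩
    · rw [← lipschitzOnWith_univ]
      exact hK.comp (lipschitzWith_radialRetraction hr).lipschitzOnWith (fun x _ => hmem x)
    · have h1 := hK.dist_le_mul _ (hmem x) 0 (by simp [hr.le])
      rw [dist_eq_norm, dist_eq_norm, sub_zero] at h1
      have h2 : ‖f t x‖ ≤ ‖f t x - g 0‖ + ‖g 0‖ := by
        simpa using norm_add_le (f t x - g 0) (g 0)
      have h3 := norm_radialRetraction_le hr x
      push_cast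
      rw [Real.coe_toNNReal _ hr.le]
      have h4 : (K : ℝ) * ‖radialRetraction r x‖ ≤ K * (2 * r) := by
        gcongr; linarith
      change ‖g (radialRetraction r x) - g 0‖ ≤ _ at h1
      change _ ≤ ‖g (radialRetraction r x) - g 0‖ + _ at h2
      linarith) (fun x => continuous_const) x₀
  have hφ : ∀ t, HasDerivAt (fun t => B (x t - xe) (x t - xe))
      (B (f t (x t)) (x t - xe) + B (x t - xe) (f t (x t))) t := fun t => by
    have h1 : HasDerivAt (fun t => x t - xe) (f t (x t)) t := (hx t).sub_const xe
    exact (B.hasFDerivAt.comp_hasDerivAt t h1).clm_apply h1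
  have hstep : ∀ t, ‖x t‖ ≤ r → B (f t (x t)) (x t - xe) + B (x t - xe) (f t (x t))
      ≤ -(2 * l) * B (x t - xe) (x t - xe) := fun t ht => by
    have := hg (x t) xe ht (by linarith)
    rw [hgxe, sub_zero] at this
    simpa only [f, radialRetraction_of_norm_le hr ht] using this
  have h0 : B (x 0 - xe) (x 0 - xe) ≤ c * r ^ 2 / 4 := by
    rcases hβ with hβ | hX
    · refine (hB' _).trans (le_trans ?_ hβρ.le)
      have : ‖x 0 - xe‖ ≤ 2 * ρ := by
        rw [hx0]; exact (norm_sub_le _ _).trans (by linarith)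
      calc β * ‖x 0 - xe‖ ^ 2 ≤ β * (2 * ρ) ^ 2 := by gcongr
        _ = _ := by ring
    · rw [Subsingleton.elim (x 0 - xe) 0]; simp; positivity
  have hball : ∀ t, B (x t - xe) (x t - xe) ≤ c * r ^ 2 / 4 → ‖x t‖ ≤ r := fun t ht => by
    have h1 : c * ‖x t - xe‖ ^ 2 ≤ c * (r / 2) ^ 2 := (hB _).trans (ht.trans_eq (by ring))
    have h2 : ‖x t - xe‖ ≤ r / 2 :=
      le_of_sq_le_sq_of_nonneg (le_of_mul_le_mul_left h1 hc) (by positivity)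
    have h3 := norm_add_le (x t - xe) xe
    rw [sub_add_cancel] at h3
    linarith
  -- The level `c r² / 4` is a barrier: it keeps `x` within `r / 2` of `xe`, hence in the ball, and
  -- on it the form strictly decreases.
  have htrap : ∀ t, 0 ≤ t → B (x t - xe) (x t - xe) ≤ c * r ^ 2 / 4 := fun T hT => by
    refine image_le_of_deriv_right_lt_deriv_boundary (a := 0) (b := T)
      (B := fun _ => c * r ^ 2 / 4) (B' := fun _ => 0)
      (fun t _ => (hφ t).continuousAt.continuousWithinAt) (fun t _ => (hφ t).hasDerivWithinAt)
      h0 (fun t => hasDerivAt_const _ _) (fun t _ ht => ?_) ⟨hT, le_rfl⟩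
    refine (hstep t (hball t ht.le)).trans_lt ?_
    rw [ht]
    have : 0 < l * (c * r ^ 2 / 4) := by positivity
    linarith
  refine ⟨x, hx0, fun t ht => ⟨?_, hball t (htrap t ht), ?_⟩⟩
  · have := hx t
    simpa only [f, radialRetraction_of_norm_le hr (hball t (htrap t ht))] using this
  · have h1 := exp_decay_of_deriv_le (c := 2 * l) (fun t _ => hφ t)
      (fun t ht => hstep t (hball t (htrap t ht))) ht
    have h2 : c * ‖x t - xe‖ ^ 2 ≤ c * (r * Real.exp (-l * t)) ^ 2 := by
      refine (hB _).trans (h1.trans ?_)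
      have h3 : (r * Real.exp (-l * t)) ^ 2 = r ^ 2 * Real.exp (-(2 * l) * t) := by
        rw [mul_pow, ← Real.exp_nat_mul]
        congr 2
        push_cast; ring
      rw [h3, ← mul_assoc]
      gcongr
      have : 0 < c * r ^ 2 := by positivity
      linarith
    exact le_of_sq_le_sq_of_nonneg (le_of_mul_le_mul_left h2 hc) (by positivity)

/-- Persistence and stability of a hyperbolic sink under small perturbations. `F (x, μ)` is a
parametrized vector field whose linearization in `x` at the equilibrium `(0, 0)` admits a quadratic
Lyapunov function. -/
theorem exists_stable_equilibria {F : X × P → X} {F' : X × P →L[ℝ] X}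
    (hF : HasStrictFDerivAt F F' 0) (hF0 : F 0 = 0) {B : X →L[ℝ] X →L[ℝ] ℝ}
    (hpos : ∀ h, h ≠ 0 → 0 < B h h)
    (hneg : ∀ h, h ≠ 0 → B (F' (h, 0)) h + B h (F' (h, 0)) < 0) {R : ℝ} (hR : 0 < R) :
    ∃ ρ, 0 < ρ ∧ ∀ ε₂, 0 < ε₂ → ∃ ε₁, 0 < ε₁ ∧ ∀ μ : P, ‖μ‖ ≤ ε₁ →
      ∃ xe, ‖xe‖ ≤ ε₂ ∧ ‖xe‖ ≤ R ∧ F (xe, μ) = 0 ∧ ∃ C l : ℝ, 0 < l ∧ ∀ x₀, ‖x₀‖ ≤ ρ →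
        ∃ x : ℝ → X, x 0 = x₀ ∧ ∀ t, 0 ≤ t →
          HasDerivAt x (F (x t, μ)) t ∧ ‖x t‖ ≤ R ∧ ‖x t - xe‖ ≤ C * Real.exp (-l * t) := by
  let A : X →L[ℝ] X := F'.comp (ContinuousLinearMap.inl ℝ X P)
  have hA : ∀ h, A h = F' (h, 0) := fun h => rfl
  obtain ⟨c, hc, hBc⟩ := exists_mul_sq_norm_le (q := fun h => B h h) (by fun_prop)
    (fun t x => by simp; ring) hpos
  obtain ⟨k, hk, hBk⟩ := exists_mul_sq_norm_le (q := fun h => -(B (A h) h + B h (A h)))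
    (by fun_prop) (fun t x => by simp; ring) (fun x hx => neg_pos.2 (hneg x hx))
  set β := ‖B‖ + 1 with hβ
  have hβ0 : 0 < β := by positivity
  have hBβ : ∀ u v, |B u v| ≤ β * ‖u‖ * ‖v‖ := fun u v => by
    refine (B.le_opNorm₂ u v).trans ?_
    gcongr
    simp [hβ]
  have hinj : Function.Injective A := by
    rw [injective_iff_map_eq_zero]
    intro h hh
    by_contra hne
    have := hneg h hne
    rw [← hA, hh] at this
    simp at this
  let e : X ≃L[ℝ] X := (LinearEquiv.ofInjectiveEndo A.toLinearMap hinj).toContinuousLinearEquiv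
  have he : ∀ x, e x = A x := fun x => rfl
  obtain ⟨N, hN⟩ : ∃ N : ℝ, ∀ y, ‖e.symm y‖ ≤ N * ‖y‖ :=
    ⟨‖(e.symm : X →L[ℝ] X)‖, fun y => (e.symm : X →L[ℝ] X).le_opNorm y⟩
  set M := |N| + 1 with hM
  have hM0 : 0 < M := by positivity
  have hN' : ∀ y, ‖e.symm y‖ ≤ M * ‖y‖ := fun y => (hN y).trans (by
    gcongr
    have := le_abs_self N
    linarith)
  -- The first bound lets the nonlinear remainder consume at most half of the decay constant `k`;
  -- the second leaves `M⁻¹ - c' ≥ M⁻¹ / 2` for the surjectivity estimate.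
  set c' : ℝ≥0 := (min (k / (4 * β)) (M⁻¹ / 2)).toNNReal with hc'
  have hc'0 : 0 < c' := Real.toNNReal_pos.2 (lt_min (by positivity) (by positivity))
  have hc'v : (c' : ℝ) = min (k / (4 * β)) (M⁻¹ / 2) :=
    Real.coe_toNNReal _ (le_min (by positivity) (by positivity))
  obtain ⟨s, hs, hFs⟩ := hF.approximates_deriv_on_nhds (c := c') (.inr hc'0)
  obtain ⟨r₁, hr₁, hr₁s⟩ := Metric.nhds_basis_closedBall.mem_iff.1 hs
  set r := min r₁ R with hr
  have hr0 : 0 < r := lt_min hr₁ hR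
  have hest : ∀ (μ : P) (x y : X), ‖μ‖ ≤ r → ‖x‖ ≤ r → ‖y‖ ≤ r →
      ‖F (x, μ) - F (y, μ) - A (x - y)‖ ≤ c' * ‖x - y‖ := fun μ x y hμ hx hy => by
    have hmem : ∀ z, ‖z‖ ≤ r → (z, μ) ∈ s := fun z hz => hr₁s (by
      simp only [mem_closedBall_zero_iff, Prod.norm_mk]
      exact (max_le hz hμ).trans (min_le_left _ _))
    have := hFs (x, μ) (hmem x hx) (y, μ) (hmem y hy)
    simpa [hA] using this
  have hcont : ∀ x y μ, ‖μ‖ ≤ r → ‖x‖ ≤ r → ‖y‖ ≤ r →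
      B (F (x, μ) - F (y, μ)) (x - y) + B (x - y) (F (x, μ) - F (y, μ))
        ≤ -(2 * (k / (4 * β))) * B (x - y) (x - y) := fun x y μ hμ hx hy => by
    have h1 := hest μ x y hμ hx hy
    set h := x - y
    set d := F (x, μ) - F (y, μ) - A h with hd
    have h2 : F (x, μ) - F (y, μ) = A h + d := by rw [hd]; abel
    rw [h2]
    simp only [map_add, add_apply]
    have h3 := hBk h
    have h4 := (abs_le.1 (hBβ d h)).2
    have h5 := (abs_le.1 (hBβ h d)).2
    have h6 : (c' : ℝ) ≤ k / (4 * β) := hc'v ▸ min_le_left _ _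
    have h7 : β * ‖d‖ * ‖h‖ ≤ k / 4 * ‖h‖ ^ 2 := by
      calc β * ‖d‖ * ‖h‖ ≤ β * (k / (4 * β) * ‖h‖) * ‖h‖ := by
            gcongr
            exact h1.trans (by gcongr)
        _ = _ := by field_simp
    have h8 : B h h ≤ β * ‖h‖ ^ 2 := (abs_le.1 (hBβ h h)).2.trans_eq (by ring)
    have h9 : 2 * (k / (4 * β)) * B h h ≤ k / 2 * ‖h‖ ^ 2 := by
      calc 2 * (k / (4 * β)) * B h h ≤ 2 * (k / (4 * β)) * (β * ‖h‖ ^ 2) := by gcongr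
        _ = _ := by field_simp; ring
    have h10 : β * ‖h‖ * ‖d‖ = β * ‖d‖ * ‖h‖ := by ring
    linarith
  -- Uniformly in small `μ`, `F (·, μ)` is close to the invertible map `A`, so it covers a ball
  -- about `F (0, μ)`; this ball contains `0` once `F (0, μ)` is small.
  have hequil : ∀ ε, 0 < ε → ∃ ε₁, 0 < ε₁ ∧ ∀ μ : P, ‖μ‖ ≤ ε₁ →
      ∃ xe, ‖xe‖ ≤ ε ∧ F (xe, μ) = 0 := by
    intro ε hε
    have hcont0 : Tendsto (fun μ : P => F (0, μ)) (𝓝 0) (𝓝 0) := by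
      have h1 : ContinuousAt F ((0, 0) : X × P) := hF.continuousAt
      have h2 : ContinuousAt (fun μ : P => F (0, μ)) 0 :=
        ContinuousAt.comp (f := fun μ : P => ((0 : X), μ)) (g := F) h1 (by fun_prop)
      have h3 : F ((0 : X), (0 : P)) = 0 := hF0
      simpa [ContinuousAt, h3] using h2
    set ε' := min ε r with hε'
    have hε'0 : 0 < ε' := lt_min hε hr0
    have hη : 0 < M⁻¹ / 2 * ε' := by positivity
    obtain ⟨δ, hδ, hδ'⟩ := Metric.nhds_basis_closedBall.mem_iff.1
      (hcont0 (Metric.closedBall_mem_nhds 0 hη))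
    refine ⟨min δ r, lt_min hδ hr0, fun μ hμ => ?_⟩
    have hμr : ‖μ‖ ≤ r := hμ.trans (min_le_right _ _)
    have hF0μ : ‖F (0, μ)‖ ≤ M⁻¹ / 2 * ε' := by
      have := hδ' (show μ ∈ Metric.closedBall 0 δ by
        simpa using hμ.trans (min_le_left _ _))
      simpa using this
    have happ : ApproximatesLinearOn (fun x => F (x, μ)) A (Metric.closedBall 0 r) c' :=
      fun x hx y hy => hest μ x y hμr (by simpa using hx) (by simpa using hy)
    let Ainv : A.NonlinearRightInverse :=
      { toFun := e.symm
        nnnorm := M.toNNReal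
        bound' := fun y => by rw [Real.coe_toNNReal _ hM0.le]; exact hN' y
        right_inv' := fun y => by rw [← he]; exact e.apply_symm_apply y }
    have hsurj := happ.surjOn_closedBall_of_nonlinearRightInverse Ainv (b := 0) hε'0.le
      (Metric.closedBall_subset_closedBall (min_le_right _ _))
    have hmem0 : (0 : X) ∈ Metric.closedBall (F (0, μ))
        (((Ainv.nnnorm : ℝ)⁻¹ - c') * ε') := by
      rw [Metric.mem_closedBall, dist_zero_left]
      refine hF0μ.trans (mul_le_mul_of_nonneg_right ?_ hε'0.le)
      have h1 : (Ainv.nnnorm : ℝ) = M := Real.coe_toNNReal _ hM0.le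
      have h2 : (c' : ℝ) ≤ M⁻¹ / 2 := hc'v ▸ min_le_right _ _
      rw [h1]; linarith
    obtain ⟨xe, hxe, hxe0⟩ := hsurj hmem0
    exact ⟨xe, (by simpa using hxe : ‖xe‖ ≤ ε').trans (min_le_left _ _), hxe0⟩
  -- The second term gives `4 β ρ² ≤ c r² / 8`. This radius depends on neither `ε₂` nor `μ`.
  set ρ := min (r / 2) (r * √(c / (β * 32))) with hρ
  have hρ0 : 0 < ρ := lt_min (by positivity) (by positivity)
  have hρsq : 4 * β * ρ ^ 2 < c * r ^ 2 / 4 := by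
    have h1 : ρ ^ 2 ≤ (r * √(c / (β * 32))) ^ 2 :=
      pow_le_pow_left₀ hρ0.le (min_le_right _ _) 2
    rw [mul_pow, Real.sq_sqrt (by positivity)] at h1
    have h2 : 4 * β * ρ ^ 2 ≤ 4 * β * (r ^ 2 * (c / (β * 32))) := by gcongr
    have h3 : 4 * β * (r ^ 2 * (c / (β * 32))) = c * r ^ 2 / 8 := by field_simp; ring
    have h4 : 0 < c * r ^ 2 := by positivity
    linarith
  refine ⟨ρ, hρ0, fun ε₂ hε₂ => ?_⟩
  obtain ⟨ε₁, hε₁, hεq⟩ := hequil (min ε₂ ρ) (lt_min hε₂ hρ0)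
  refine ⟨min ε₁ r, lt_min hε₁ hr0, fun μ hμ => ?_⟩
  have hμr : ‖μ‖ ≤ r := hμ.trans (min_le_right _ _)
  obtain ⟨xe, hxe, hFxe⟩ := hεq μ (hμ.trans (min_le_left _ _))
  have hxeρ : ‖xe‖ ≤ ρ := hxe.trans (min_le_right _ _)
  have hρr : ρ ≤ r / 2 := min_le_left _ _
  have hrR : r ≤ R := min_le_right _ _
  refine ⟨xe, hxe.trans (min_le_left _ _), by linarith, hFxe, r, k / (4 * β), by positivity,
    fun x₀ hx₀ => ?_⟩
  have hlip : LipschitzOnWith (‖A‖₊ + c') (fun x => F (x, μ)) (Metric.closedBall 0 r) := by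
    refine LipschitzOnWith.of_dist_le_mul fun x hx y hy => ?_
    rw [dist_eq_norm, dist_eq_norm]
    have h1 := hest μ x y hμr (by simpa using hx) (by simpa using hy)
    have h2 := A.le_opNorm (x - y)
    have h3 := norm_add_le (F (x, μ) - F (y, μ) - A (x - y)) (A (x - y))
    rw [sub_add_cancel] at h3
    push_cast
    linarith
  obtain ⟨x, hx0, hx⟩ := exists_solution_of_contracting hr0 hc
    (by positivity : 0 < k / (4 * β)) hlip hBc
    (fun h => (abs_le.1 (hBβ h h)).2.trans_eq (by ring : _ = β * ‖h‖ ^ 2))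
    (fun x y hx hy => hcont x y μ hμr hx hy) hρr hρsq hxeρ hFxe hx₀
  exact ⟨x, hx0, fun t ht => ⟨(hx t ht).1, (hx t ht).2.1.trans hrR, (hx t ht).2.2⟩⟩

end Stability

/-! ### Matrices acting on Euclidean space, and the rotation group. -/

section Act

variable {m : ℕ}

theorem act_apply (A : Matrix (Fin m) (Fin m) ℝ) (x : Space m) (i : Fin m) :
    act A x i = ∑ j, A i j * x j := rfl

theorem act_add (A : Matrix (Fin m) (Fin m) ℝ) (x y : Space m) :
    act A (x + y) = act A x + act A y := by
  ext i; simp [act_apply, mul_add, Finset.sum_add_distrib]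

theorem act_sub (A : Matrix (Fin m) (Fin m) ℝ) (x y : Space m) :
    act A (x - y) = act A x - act A y := by
  ext i; simp [act_apply, mul_sub, Finset.sum_sub_distrib]

theorem act_neg (A : Matrix (Fin m) (Fin m) ℝ) (x : Space m) : act A (-x) = -act A x := by
  ext i; simp [act_apply]

theorem act_smul (A : Matrix (Fin m) (Fin m) ℝ) (c : ℝ) (x : Space m) :
    act A (c • x) = c • act A x := by
  ext i; simp [act_apply, Finset.mul_sum, mul_left_comm]

theorem act_sum {ι : Type*} (A : Matrix (Fin m) (Fin m) ℝ) (s : Finset ι) (x : ι → Space m) :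
    act A (∑ i ∈ s, x i) = ∑ i ∈ s, act A (x i) := by
  classical
  induction s using Finset.induction_on with
  | empty => ext i; simp [act_apply]
  | insert a s ha ih => rw [Finset.sum_insert ha, Finset.sum_insert ha, act_add, ih]

theorem add_act (A B : Matrix (Fin m) (Fin m) ℝ) (x : Space m) :
    act (A + B) x = act A x + act B x := by
  ext i; simp [act_apply, add_mul, Finset.sum_add_distrib]

theorem smul_act (c : ℝ) (A : Matrix (Fin m) (Fin m) ℝ) (x : Space m) :
    act (c • A) x = c • act A x := by
  ext i; simp [act_apply, Finset.mul_sum, mul_assoc]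

theorem zero_act (x : Space m) : act (0 : Matrix (Fin m) (Fin m) ℝ) x = 0 := by
  ext i; simp [act_apply]

theorem act_mul (A B : Matrix (Fin m) (Fin m) ℝ) (x : Space m) :
    act (A * B) x = act A (act B x) := by
  simp [act, Matrix.mulVec_mulVec]

theorem one_act (x : Space m) : act (1 : Matrix (Fin m) (Fin m) ℝ) x = x := by
  simp [act]

theorem inner_eq_sum (x y : Space m) : inner ℝ x y = ∑ i, x i * y i := by
  simp [PiLp.inner_apply, mul_comm]

theorem inner_act_left (A : Matrix (Fin m) (Fin m) ℝ) (x y : Space m) :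
    inner ℝ (act A x) y = inner ℝ x (act Aᵀ y) := by
  simp only [inner_eq_sum, act_apply, Matrix.transpose_apply, Finset.sum_mul, Finset.mul_sum]
  rw [Finset.sum_comm]
  exact Finset.sum_congr rfl fun i _ => Finset.sum_congr rfl fun j _ => by ring

theorem inner_skew_act_self {A : Matrix (Fin m) (Fin m) ℝ} (hA : Aᵀ = -A) (x : Space m) :
    inner ℝ x (act A x) = 0 := by
  have h := inner_act_left A x x
  rw [hA, ← neg_one_smul ℝ A, smul_act, inner_smul_right, real_inner_comm] at h
  linarith

theorem mul_transpose_of_mem {Q : Matrix (Fin m) (Fin m) ℝ}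
    (hQ : Q ∈ Matrix.specialOrthogonalGroup (Fin m) ℝ) : Q * Qᵀ = 1 :=
  (Matrix.mem_orthogonalGroup_iff _ _).1 (Matrix.mem_specialOrthogonalGroup_iff.1 hQ).1

theorem transpose_mul_of_mem {Q : Matrix (Fin m) (Fin m) ℝ}
    (hQ : Q ∈ Matrix.specialOrthogonalGroup (Fin m) ℝ) : Qᵀ * Q = 1 :=
  (Matrix.mem_orthogonalGroup_iff' _ _).1 (Matrix.mem_specialOrthogonalGroup_iff.1 hQ).1

theorem mem_specialOrthogonalGroup_iff_transpose {Q : Matrix (Fin m) (Fin m) ℝ} :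
    Q ∈ Matrix.specialOrthogonalGroup (Fin m) ℝ ↔ Q * Qᵀ = 1 ∧ Q.det = 1 := by
  rw [Matrix.mem_specialOrthogonalGroup_iff, Matrix.mem_orthogonalGroup_iff]

theorem transpose_mem {Q : Matrix (Fin m) (Fin m) ℝ}
    (hQ : Q ∈ Matrix.specialOrthogonalGroup (Fin m) ℝ) :
    Qᵀ ∈ Matrix.specialOrthogonalGroup (Fin m) ℝ := by
  rw [mem_specialOrthogonalGroup_iff_transpose] at hQ ⊢
  rw [Matrix.transpose_transpose, Matrix.det_transpose]
  exact ⟨mul_eq_one_comm.1 hQ.1, hQ.2⟩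

theorem inner_act_act {Q : Matrix (Fin m) (Fin m) ℝ} (hQ : Qᵀ * Q = 1) (x y : Space m) :
    inner ℝ (act Q x) (act Q y) = inner ℝ x y := by
  rw [inner_act_left, ← act_mul, hQ, one_act]

theorem norm_act {Q : Matrix (Fin m) (Fin m) ℝ} (hQ : Qᵀ * Q = 1) (x : Space m) :
    ‖act Q x‖ = ‖x‖ := by
  rw [← sq_eq_sq₀ (norm_nonneg _) (norm_nonneg _), ← real_inner_self_eq_norm_sq,
    ← real_inner_self_eq_norm_sq, inner_act_act hQ]

theorem abs_entry_le_one {Q : Matrix (Fin m) (Fin m) ℝ} (hQ : Q * Qᵀ = 1) (i j : Fin m) :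
    |Q i j| ≤ 1 := by
  have h : ∑ k, Q i k * Q i k = 1 := by
    have := congrFun (congrFun hQ i) i
    simpa [Matrix.mul_apply] using this
  have h2 : Q i j * Q i j ≤ 1 := h ▸
    Finset.single_le_sum (f := fun k => Q i k * Q i k) (fun k _ => mul_self_nonneg _)
      (Finset.mem_univ j)
  exact abs_le_one_iff_mul_self_le_one.2 h2

theorem isClosed_specialOrthogonalGroup :
    IsClosed {Q : Matrix (Fin m) (Fin m) ℝ | Q ∈ Matrix.specialOrthogonalGroup (Fin m) ℝ} := by
  simp only [mem_specialOrthogonalGroup_iff_transpose, ofPred_and]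
  exact (isClosed_eq (by fun_prop) continuous_const).inter
    (isClosed_eq (by fun_prop) continuous_const)

theorem isCompact_specialOrthogonalGroup :
    IsCompact {Q : Matrix (Fin m) (Fin m) ℝ | Q ∈ Matrix.specialOrthogonalGroup (Fin m) ℝ} := by
  have h : IsCompact (Set.pi univ fun _ : Fin m => Set.pi univ fun _ : Fin m => Icc (-1 : ℝ) 1) :=
    isCompact_univ_pi fun _ => isCompact_univ_pi fun _ => isCompact_Icc
  refine h.of_isClosed_subset isClosed_specialOrthogonalGroup fun Q hQ => ?_
  exact fun i _ j _ => abs_le.1 (abs_entry_le_one (mul_transpose_of_mem hQ) i j)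

theorem hasDerivAt_space_iff {u : ℝ → Space m} {u' : Space m} {t : ℝ} :
    HasDerivAt u u' t ↔ ∀ i, HasDerivAt (fun τ => u τ i) (u' i) t := by
  refine ⟨fun h i => (EuclideanSpace.proj (𝕜 := ℝ) i).hasFDerivAt.comp_hasDerivAt t h,
    fun h => ?_⟩
  exact (PiLp.continuousLinearEquiv 2 ℝ fun _ : Fin m => ℝ).symm.hasFDerivAt.comp_hasDerivAt t
    (hasDerivAt_pi.2 h)

theorem hasDerivAt_act {Q : ℝ → Matrix (Fin m) (Fin m) ℝ} {Q' : Matrix (Fin m) (Fin m) ℝ}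
    {u : ℝ → Space m} {u' : Space m} {t : ℝ}
    (hQ : ∀ i j, HasDerivAt (fun τ => Q τ i j) (Q' i j) t) (hu : HasDerivAt u u' t) :
    HasDerivAt (fun τ => act (Q τ) (u τ)) (act Q' (u t) + act (Q t) u') t := by
  rw [hasDerivAt_space_iff] at hu ⊢
  intro i
  have := HasDerivAt.fun_sum (u := Finset.univ) fun j _ => (hQ i j).mul (hu j)
  simpa [act_apply, Finset.sum_add_distrib] using this

theorem tendsto_act {ι : Type*} {l : Filter ι} {Q : ι → Matrix (Fin m) (Fin m) ℝ}
    {Q' : Matrix (Fin m) (Fin m) ℝ} {u : ι → Space m} {u' : Space m}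
    (hQ : ∀ i j, Tendsto (fun τ => Q τ i j) l (𝓝 (Q' i j))) (hu : Tendsto u l (𝓝 u')) :
    Tendsto (fun τ => act (Q τ) (u τ)) l (𝓝 (act Q' u')) := by
  have h : Tendsto (fun τ => Q τ *ᵥ WithLp.ofLp (u τ)) l (𝓝 (Q' *ᵥ WithLp.ofLp u')) := by
    rw [tendsto_pi_nhds]
    intro i
    change Tendsto (fun τ => ∑ j, Q τ i j * u τ j) l (𝓝 (∑ j, Q' i j * u' j))
    refine tendsto_finsetSum _ fun j _ => (hQ i j).mul ?_
    exact ((EuclideanSpace.proj (𝕜 := ℝ) j).continuous.tendsto u').comp hu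
  exact ((PiLp.continuous_toLp 2 _).tendsto _).comp h

end Act

/-! ### Moving frames with prescribed angular velocity. -/

section Frames

variable {m : ℕ}

theorem norm_mul_le_of_entry_le {A Ω : Matrix (Fin m) (Fin m) ℝ} {a C : ℝ} (ha : 0 ≤ a)
    (hA : ∀ i j, |A i j| ≤ a) (hC : ∀ i j, |Ω i j| ≤ C) (i j : Fin m) :
    |(A * Ω) i j| ≤ m * (a * C) := by
  rw [Matrix.mul_apply]
  refine (Finset.abs_sum_le_sum_abs _ _).trans ?_
  refine (Finset.sum_le_card_nsmul _ _ (a * C) fun k _ => ?_).trans (by simp)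
  rw [abs_mul]
  exact mul_le_mul (hA i k) (hC k j) (abs_nonneg _) ha

/-- The moving frame with a prescribed angular velocity, given in the body frame, stays in the
rotation group. -/
theorem exists_frame {Ω : ℝ → Matrix (Fin m) (Fin m) ℝ}
    (hΩ : ∀ i j, Continuous fun t => Ω t i j) (hskew : ∀ t, (Ω t)ᵀ = -Ω t)
    {Q₀ : Matrix (Fin m) (Fin m) ℝ} (hQ₀ : Q₀ ∈ Matrix.specialOrthogonalGroup (Fin m) ℝ) :
    ∃ Q : ℝ → Matrix (Fin m) (Fin m) ℝ, Q 0 = Q₀ ∧ ∀ t,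
      Q t ∈ Matrix.specialOrthogonalGroup (Fin m) ℝ ∧
      ∀ i j, HasDerivAt (fun τ => Q τ i j) ((Q t * Ω t) i j) t := by
  let E := Fin m → Fin m → ℝ
  let g : ℝ → E → E := fun t A i j => (Matrix.of A * Ω t) i j
  -- The truncation makes the field bounded. It only multiplies `A * Ω t` by a scalar, so `A * Aᵀ`
  -- is still conserved; the entries therefore stay in `[-1, 1]` and the truncation is never active.
  let f : ℝ → E → E := fun t A => g t (radialRetraction 1 A)
  obtain ⟨Q, hQ0, hQ⟩ := exists_global_solution (f := f) (fun T => by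
    have hc : Continuous fun t => (fun i j => Ω t i j : E) :=
      continuous_pi fun i => continuous_pi fun j => hΩ i j
    obtain ⟨C, hC⟩ := (isCompact_Icc (a := -T) (b := T)).exists_bound_of_continuousOn
      hc.continuousOn
    have hC' : ∀ t, |t| ≤ T → ∀ i j, |Ω t i j| ≤ max C 0 := fun t ht i j =>
      (((norm_le_pi_norm _ j).trans (norm_le_pi_norm (fun i j => Ω t i j : E) i)).trans
        (hC t (abs_le.1 ht))).trans (le_max_left _ _)
    have hC0 : 0 ≤ max C 0 := le_max_right _ _
    have hbd : ∀ t, |t| ≤ T → ∀ A : E, ‖g t A‖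
        ≤ m * max C 0 * ‖A‖ := fun t ht A => by
      rw [pi_norm_le_iff_of_nonneg (by positivity)]
      intro i
      rw [pi_norm_le_iff_of_nonneg (by positivity)]
      intro j
      refine (norm_mul_le_of_entry_le (norm_nonneg A) (fun i j => ?_) (hC' t ht) i j).trans
        (by rw [mul_comm ‖A‖, mul_assoc])
      exact (norm_le_pi_norm _ j).trans (norm_le_pi_norm A i)
    refine ⟨(m * max C 0).toNNReal * 2, (m * max C 0).toNNReal, fun t ht => ⟨?_, fun A => ?_⟩⟩
    · have h1 : LipschitzWith (m * max C 0).toNNReal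
          (g t) := by
        refine LipschitzWith.of_dist_le_mul fun A B => ?_
        rw [dist_eq_norm, dist_eq_norm, Real.coe_toNNReal _ (by positivity)]
        refine le_trans (le_of_eq ?_) (hbd t ht (A - B))
        congr 1
        ext i j
        change (Matrix.of A * Ω t) i j - (Matrix.of B * Ω t) i j
          = ((Matrix.of A - Matrix.of B) * Ω t) i j
        rw [Matrix.sub_mul, Matrix.sub_apply]
      exact h1.comp (lipschitzWith_radialRetraction one_pos)
    · rw [Real.coe_toNNReal _ (by positivity)]
      exact (hbd t ht _).trans (mul_le_of_le_one_right (by positivity)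
        (norm_radialRetraction_le one_pos A)))
    (fun A => continuous_pi fun i => continuous_pi fun j => by
      simp only [f, g, Matrix.mul_apply]
      exact continuous_finsetSum _ fun k _ => continuous_const.mul (hΩ k j)) Q₀
  let τ : ℝ → ℝ := fun t => 1 / max 1 ‖Q t‖
  have hQ' : ∀ t i j, HasDerivAt (fun s => Q s i j)
      (τ t * (Matrix.of (Q t) * Ω t) i j) t := fun t i j => by
    have := hasDerivAt_pi.1 (hasDerivAt_pi.1 (hQ t) i) j
    have h : f t (Q t) i j = τ t * (Matrix.of (Q t) * Ω t) i j := by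
      simp only [f, g, radialRetraction, Matrix.mul_apply, Matrix.of_apply, Finset.mul_sum, τ]
      exact Finset.sum_congr rfl fun k _ => mul_assoc _ _ _
    rwa [h] at this
  have hortho : ∀ t, Matrix.of (Q t) * (Matrix.of (Q t))ᵀ = 1 := fun t => by
    ext i j
    have hd : ∀ s, HasDerivAt (fun s => (Matrix.of (Q s) * (Matrix.of (Q s))ᵀ) i j) 0 s :=
      fun s => by
      have h1 := HasDerivAt.fun_sum (u := Finset.univ) fun k _ => (hQ' s i k).mul (hQ' s j k)
      have h2 : ∑ k, (τ s * (Matrix.of (Q s) * Ω s) i k * Q s j k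
          + Q s i k * (τ s * (Matrix.of (Q s) * Ω s) j k)) = 0 := by
        have h3 : ∑ k, (Matrix.of (Q s) * Ω s) i k * Q s j k
            = (Matrix.of (Q s) * Ω s * (Matrix.of (Q s))ᵀ) i j := by
          simp [Matrix.mul_apply]
        have h4 : ∑ k, Q s i k * (Matrix.of (Q s) * Ω s) j k
            = (Matrix.of (Q s) * (Matrix.of (Q s) * Ω s)ᵀ) i j := by
          rw [Matrix.mul_apply]
          rfl
        have h5 : Matrix.of (Q s) * (Matrix.of (Q s) * Ω s)ᵀ
            = -(Matrix.of (Q s) * Ω s * (Matrix.of (Q s))ᵀ) := by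
          rw [Matrix.transpose_mul, hskew, Matrix.neg_mul, Matrix.mul_neg, Matrix.mul_assoc]
        rw [Finset.sum_add_distrib]
        simp_rw [mul_assoc, mul_left_comm _ (τ s), ← Finset.mul_sum]
        rw [h3, h4, h5, Matrix.neg_apply]
        ring
      rw [h2] at h1
      simpa [Matrix.mul_apply] using h1
    have hconst := is_const_of_deriv_eq_zero (fun s => (hd s).differentiableAt)
      (fun s => (hd s).deriv) t 0
    rw [hconst, hQ0]
    exact congrFun (congrFun (mul_transpose_of_mem hQ₀) i) j
  have hτ : ∀ t, τ t = 1 := fun t => by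
    have : ‖Q t‖ ≤ 1 := by
      rw [pi_norm_le_iff_of_nonneg zero_le_one]
      intro i
      rw [pi_norm_le_iff_of_nonneg zero_le_one]
      exact fun j => abs_entry_le_one (hortho t) i j
    simp [τ, max_eq_left this]
  refine ⟨fun t => Matrix.of (Q t), hQ0, fun t => ⟨?_, fun i j => by
    have := hQ' t i j
    rwa [hτ, one_mul] at this⟩⟩
  rw [mem_specialOrthogonalGroup_iff_transpose]
  refine ⟨hortho t, ?_⟩
  have hcont : Continuous fun s => (Matrix.of (Q s)).det := by
    refine Continuous.matrix_det ?_
    exact continuous_pi fun i => continuous_pi fun j =>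
      continuous_iff_continuousAt.2 fun s => (hQ' s i j).continuousAt
  have hsq : EqOn ((fun s => (Matrix.of (Q s)).det) ^ 2) ((fun _ => 1) ^ 2) (univ : Set ℝ) :=
    fun s _ => by
      have := congrArg Matrix.det (hortho s)
      rw [Matrix.det_mul, Matrix.det_transpose, Matrix.det_one] at this
      simpa [sq] using this
  have h0 : (Matrix.of (Q 0)).det = 1 := by
    rw [hQ0]; exact (mem_specialOrthogonalGroup_iff_transpose.1 hQ₀).2
  rcases isPreconnected_univ.eq_or_eq_neg_of_sq_eq hcont.continuousOn continuousOn_const hsq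
    (fun _ => one_ne_zero) with h | h
  · exact h (mem_univ t)
  · have := h (mem_univ 0)
    simp only [Pi.neg_apply, h0] at this
    norm_num at this

/-- The derivative is integrable on the half-line. -/
theorem exists_tendsto_of_deriv_exp_decay {f f' : ℝ → ℝ} {C l : ℝ} (hl : 0 < l)
    (hf : ∀ t, 0 ≤ t → HasDerivAt f (f' t) t)
    (hC : ∀ t, 0 ≤ t → |f' t| ≤ C * Real.exp (-l * t)) : ∃ L, Tendsto f atTop (𝓝 L) := by
  refine ⟨_, MeasureTheory.tendsto_limUnder_of_hasDerivAt_of_integrableOn_Ioi (a := 0)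
    (f' := deriv f) (fun t ht => ?_) ?_⟩
  · have := hf t (le_of_lt ht)
    rwa [this.deriv]
  · refine MeasureTheory.Integrable.mono' ((exp_neg_integrableOn_Ioi 0 hl).const_mul C)
      (measurable_deriv f).aestronglyMeasurable ?_
    refine (MeasureTheory.ae_restrict_iff' measurableSet_Ioi).2 (.of_forall fun t ht => ?_)
    have ht' : 0 ≤ t := le_of_lt ht
    rw [(hf t ht').deriv]
    exact hC t ht'

/-- A frame whose angular velocity converges exponentially is asymptotic, with phase, to a frame
with constant angular velocity. -/
theorem exists_asymptotic_frame {Q Ω : ℝ → Matrix (Fin m) (Fin m) ℝ}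
    {Ωe : Matrix (Fin m) (Fin m) ℝ} {C l : ℝ} (hl : 0 < l) (hskew : Ωeᵀ = -Ωe)
    (hQ : ∀ t, 0 ≤ t → Q t ∈ Matrix.specialOrthogonalGroup (Fin m) ℝ)
    (hQ' : ∀ t, 0 ≤ t → ∀ i j, HasDerivAt (fun τ => Q τ i j) ((Q t * Ω t) i j) t)
    (hC : ∀ t, 0 ≤ t → ∀ i j, |Ω t i j - Ωe i j| ≤ C * Real.exp (-l * t)) :
    ∃ Qe : ℝ → Matrix (Fin m) (Fin m) ℝ,
      (∀ t, Qe t ∈ Matrix.specialOrthogonalGroup (Fin m) ℝ) ∧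
      (∀ t i j, HasDerivAt (fun τ => Qe τ i j) ((Qe t * Ωe) i j) t) ∧
      ∀ i j, Tendsto (fun t => Q t i j - Qe t i j) atTop (𝓝 0) := by
  obtain ⟨E, -, hE⟩ := exists_frame (Ω := fun _ => Ωe) (fun _ _ => continuous_const)
    (fun _ => hskew) (one_mem (Matrix.specialOrthogonalGroup (Fin m) ℝ))
  -- By skewness of `Ωe` the derivative of `H` is `Q (Ω - Ωe) Eᵀ`, which decays exponentially. The
  -- limit `L` of `H` is the asymptotic phase, and `L E` the limiting frame.
  let H : ℝ → Matrix (Fin m) (Fin m) ℝ := fun t => Q t * (E t)ᵀ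
  have hHd : ∀ t, 0 ≤ t → ∀ i j, HasDerivAt (fun τ => H τ i j)
      ((Q t * (Ω t - Ωe) * (E t)ᵀ) i j) t := fun t ht i j => by
    have h1 := HasDerivAt.fun_sum (u := Finset.univ) fun k _ =>
      (hQ' t ht i k).mul ((hE t).2 j k)
    have h2 : (Q t * (Ω t - Ωe) * (E t)ᵀ) i j
        = ∑ k, ((Q t * Ω t) i k * E t j k + Q t i k * (E t * Ωe) j k) := by
      have h3 : Q t * (Ω t - Ωe) * (E t)ᵀ = Q t * Ω t * (E t)ᵀ + Q t * (E t * Ωe)ᵀ := by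
        rw [Matrix.transpose_mul, hskew]
        noncomm_ring
      rw [h3, Finset.sum_add_distrib]
      simp only [Matrix.add_apply]
      rw [Matrix.mul_apply, Matrix.mul_apply (M := Q t)]
      simp only [Matrix.transpose_apply]
    rw [h2]
    simpa [H, Matrix.mul_apply] using h1
  have hHb : ∀ t, 0 ≤ t → ∀ i j, |(Q t * (Ω t - Ωe) * (E t)ᵀ) i j|
      ≤ m * (m * (1 * C) * 1) * Real.exp (-l * t) := fun t ht i j => by
    have hC0 : 0 ≤ C := by
      have h1 := (abs_nonneg _).trans (hC t ht i j)
      exact nonneg_of_mul_nonneg_left h1 (Real.exp_pos _)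
    have h1 := norm_mul_le_of_entry_le (zero_le_one' ℝ)
      (abs_entry_le_one (mul_transpose_of_mem (hQ t ht)))
      (fun i j => (by simpa using hC t ht i j : |(Ω t - Ωe) i j| ≤ C * Real.exp (-l * t)))
    refine (norm_mul_le_of_entry_le (by positivity) h1
      (abs_entry_le_one (mul_transpose_of_mem (transpose_mem (hE t).1))) i j).trans
      (le_of_eq (by ring))
  have hlim : ∀ i j, ∃ L, Tendsto (fun t => H t i j) atTop (𝓝 L) := fun i j =>
    exists_tendsto_of_deriv_exp_decay hl (fun t ht => hHd t ht i j) (fun t ht => hHb t ht i j)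
  choose L hL using hlim
  have hLt : Tendsto H atTop (𝓝 (Matrix.of L)) :=
    tendsto_pi_nhds.2 fun i => tendsto_pi_nhds.2 fun j => hL i j
  have hLmem : Matrix.of L ∈ Matrix.specialOrthogonalGroup (Fin m) ℝ :=
    isClosed_specialOrthogonalGroup.mem_of_tendsto hLt
      ((eventually_ge_atTop 0).mono fun t ht => mul_mem (hQ t ht) (transpose_mem (hE t).1))
  refine ⟨fun t => Matrix.of L * E t, fun t => mul_mem hLmem (hE t).1, fun t i j => ?_,
    fun i j => ?_⟩
  · have h1 := HasDerivAt.fun_sum (u := Finset.univ) fun k _ =>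
      ((hE t).2 k j).const_mul (Matrix.of L i k)
    rw [Matrix.mul_assoc]
    simpa [Matrix.mul_apply] using h1
  · have h1 : ∀ t, Q t i j - (Matrix.of L * E t) i j = ∑ k, (H t i k - L i k) * E t k j :=
      fun t => by
      have h2 : Q t = H t * E t := by
        rw [Matrix.mul_assoc, transpose_mul_of_mem (hE t).1, Matrix.mul_one]
      conv_lhs => rw [h2]
      simp [Matrix.mul_apply, sub_mul, Finset.sum_sub_distrib]
    simp_rw [h1]
    rw [← Finset.sum_const_zero (s := (Finset.univ : Finset (Fin m)))]
    refine tendsto_finsetSum _ fun k _ => ?_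
    have h2 : Tendsto (fun t => H t i k - L i k) atTop (𝓝 0) := by
      simpa using (hL i k).sub_const (L i k)
    refine squeeze_zero_norm (fun t => ?_) (by simpa using h2.norm)
    rw [norm_mul]
    exact mul_le_of_le_one_right (norm_nonneg _)
      (abs_entry_le_one (mul_transpose_of_mem (hE t).1) k j)

end Frames

/-! ### The rigidity map, its transpose, and their equivariance. -/

section Linear

variable {m n r : ℕ}

theorem relPos_add (G : SensingGraph n r) (p q : Fin n → Space m) (k : Fin r) :
    relPos G (p + q) k = relPos G p k + relPos G q k := by
  simp [relPos]; abel

theorem relPos_smul (G : SensingGraph n r) (c : ℝ) (p : Fin n → Space m) (k : Fin r) :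
    relPos G (c • p) k = c • relPos G p k := by
  simp [relPos, smul_sub]

theorem relPos_rigidMotion (G : SensingGraph n r) (c : Space m) (Q : Matrix (Fin m) (Fin m) ℝ)
    (p : Fin n → Space m) (k : Fin r) :
    relPos G (fun i => c + act Q (p i)) k = act Q (relPos G p k) := by
  simp [relPos, act_sub]

theorem sum_incidence_smul {M : Type*} [AddCommGroup M] [Module ℝ M] (G : SensingGraph n r)
    (k : Fin r) (f : Fin n → M) :
    ∑ i, G.incidence i k • f i = f (G.tail k) - f (G.head k) := by
  have h : ∀ i, G.incidence i k • f i
      = (if i = G.tail k then f i else 0) - (if i = G.head k then f i else 0) := fun i => by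
    have hne := G.tail_ne_head k
    unfold SensingGraph.incidence
    split_ifs with h1 h2 h2
    · exact absurd (h1.symm.trans h2) hne
    · simp
    · simp
    · simp
  simp only [h, Finset.sum_sub_distrib, Finset.sum_ite_eq', Finset.mem_univ, if_true]

/-- The bilinear map `(p, y) ↦ R(p)ᵀ y`. -/
noncomputable def edgeForce (G : SensingGraph n r) :
    (Fin n → Space m) →ₗ[ℝ] EuclideanSpace ℝ (Fin r) →ₗ[ℝ] (Fin n → Space m) :=
  LinearMap.mk₂ ℝ (fun p y i => ∑ k, (G.incidence i k * y k) • relPos G p k)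
    (fun p q y => by ext1 i; simp [relPos_add, Finset.sum_add_distrib])
    (fun c p y => by
      ext1 i
      simp only [relPos_smul, Pi.smul_apply, Finset.smul_sum]
      exact Finset.sum_congr rfl fun k _ => smul_comm _ _ _)
    (fun p y z => by ext1 i; simp [mul_add, add_smul, Finset.sum_add_distrib])
    (fun c p y => by
      ext1 i
      simp only [PiLp.smul_apply, smul_eq_mul, Pi.smul_apply, Finset.smul_sum, smul_smul]
      exact Finset.sum_congr rfl fun k _ => by congr 1; ring)

theorem edgeForce_apply (G : SensingGraph n r) (p : Fin n → Space m)
    (y : EuclideanSpace ℝ (Fin r)) (i : Fin n) :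
    edgeForce G p y i = ∑ k, (G.incidence i k * y k) • relPos G p k := rfl

/-- The bilinear map `(p, μ) ↦ (S₁ ⊗ I) D_z μ`. -/
noncomputable def mismatchForce (G : SensingGraph n r) :
    (Fin n → Space m) →ₗ[ℝ] EuclideanSpace ℝ (Fin r) →ₗ[ℝ] (Fin n → Space m) :=
  LinearMap.mk₂ ℝ (fun p y i => ∑ k, (G.tailIncidence i k * y k) • relPos G p k)
    (fun p q y => by ext1 i; simp [relPos_add, Finset.sum_add_distrib])
    (fun c p y => by
      ext1 i
      simp only [relPos_smul, Pi.smul_apply, Finset.smul_sum]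
      exact Finset.sum_congr rfl fun k _ => smul_comm _ _ _)
    (fun p y z => by ext1 i; simp [mul_add, add_smul, Finset.sum_add_distrib])
    (fun c p y => by
      ext1 i
      simp only [PiLp.smul_apply, smul_eq_mul, Pi.smul_apply, Finset.smul_sum, smul_smul]
      exact Finset.sum_congr rfl fun k _ => by congr 1; ring)

theorem mismatchForce_apply (G : SensingGraph n r) (p : Fin n → Space m)
    (y : EuclideanSpace ℝ (Fin r)) (i : Fin n) :
    mismatchForce G p y i = ∑ k, (G.tailIncidence i k * y k) • relPos G p k := rfl

theorem control_eq (G : SensingGraph n r) (pd : Fin n → Space m) (μ : EuclideanSpace ℝ (Fin r))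
    (p v : Fin n → Space m) :
    control G pd μ p v = -v - edgeForce G p (distError G pd p) - mismatchForce G p μ := rfl

/-- The bilinear map `(p, q) ↦ R(p) q`. -/
noncomputable def rigidityMap (G : SensingGraph n r) :
    (Fin n → Space m) →ₗ[ℝ] (Fin n → Space m) →ₗ[ℝ] EuclideanSpace ℝ (Fin r) :=
  LinearMap.mk₂ ℝ (fun p q => WithLp.toLp 2 fun k => inner ℝ (relPos G p k) (relPos G q k))
    (fun p q y => by ext k; simp [relPos_add, inner_add_left])
    (fun c p y => by ext k; simp [relPos_smul, inner_smul_left])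
    (fun p y z => by ext k; simp [relPos_add, inner_add_right])
    (fun c p y => by ext k; simp [relPos_smul, inner_smul_right])

theorem rigidityMap_apply (G : SensingGraph n r) (p q : Fin n → Space m) (k : Fin r) :
    rigidityMap G p q k = inner ℝ (relPos G p k) (relPos G q k) := rfl

/-- The Euclidean inner product of two configurations. -/
noncomputable def dot : (Fin n → Space m) →ₗ[ℝ] (Fin n → Space m) →ₗ[ℝ] ℝ :=
  LinearMap.mk₂ ℝ (fun u v => ∑ i, inner ℝ (u i) (v i))
    (fun p q y => by simp [inner_add_left, Finset.sum_add_distrib])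
    (fun c p y => by simp [inner_smul_left, Finset.mul_sum])
    (fun p y z => by simp [inner_add_right, Finset.sum_add_distrib])
    (fun c p y => by simp [inner_smul_right, Finset.mul_sum])

theorem dot_apply (u v : Fin n → Space m) : dot u v = ∑ i, inner ℝ (u i) (v i) := rfl

theorem dot_comm (u v : Fin n → Space m) : dot u v = dot v u := by
  simp only [dot_apply, real_inner_comm]

theorem dot_self_pos {u : Fin n → Space m} (hu : u ≠ 0) : 0 < dot u u := by
  obtain ⟨i, hi⟩ := Function.ne_iff.1 hu
  exact Finset.sum_pos' (fun i _ => real_inner_self_nonneg)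
    ⟨i, Finset.mem_univ i, real_inner_self_pos.2 hi⟩

theorem eq_zero_of_dot_self {u : Fin n → Space m} (hu : dot u u = 0) : u = 0 := by
  by_contra h
  exact (dot_self_pos h).ne' hu

theorem dot_self_nonneg (u : Fin n → Space m) : 0 ≤ dot u u := by
  rw [dot_apply]
  exact Finset.sum_nonneg fun _ _ => real_inner_self_nonneg

/-- Summation by parts over the edges: `edgeForce G p` is the transpose of `rigidityMap G p`. The
energy identities below rest on this. -/
theorem dot_edgeForce (G : SensingGraph n r) (p q : Fin n → Space m)
    (y : EuclideanSpace ℝ (Fin r)) :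
    dot (edgeForce G p y) q = inner ℝ y (rigidityMap G p q) := by
  simp only [dot_apply, edgeForce_apply, sum_inner, real_inner_smul_left]
  rw [inner_eq_sum, Finset.sum_comm]
  refine Finset.sum_congr rfl fun k _ => ?_
  have h := sum_incidence_smul G k fun i => inner ℝ (relPos G p k) (q i)
  rw [← inner_sub_right] at h
  change _ = y k * inner ℝ (relPos G p k) (q (G.tail k) - q (G.head k))
  rw [← h, Finset.mul_sum]
  exact Finset.sum_congr rfl fun i _ => by simp only [smul_eq_mul]; ring

/-- The two ends of an edge receive opposite forces. Hence moving along the slice preserves the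
centroid, and these forces are orthogonal to translations. -/
theorem sum_edgeForce (G : SensingGraph n r) (p : Fin n → Space m)
    (y : EuclideanSpace ℝ (Fin r)) : ∑ i, edgeForce G p y i = 0 := by
  simp only [edgeForce_apply]
  rw [Finset.sum_comm]
  refine Finset.sum_eq_zero fun k _ => ?_
  have h := sum_incidence_smul G k fun _ => y k • relPos G p k
  rw [sub_self] at h
  rw [← h]
  exact Finset.sum_congr rfl fun i _ => by rw [mul_smul]

/-- Equivariance under rigid motions is what lets the closed loop descend to the slice. -/
theorem edgeForce_rigidMotion (G : SensingGraph n r) (c : Space m)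
    (Q : Matrix (Fin m) (Fin m) ℝ) (p : Fin n → Space m) (y : EuclideanSpace ℝ (Fin r))
    (i : Fin n) :
    edgeForce G (fun i => c + act Q (p i)) y i = act Q (edgeForce G p y i) := by
  simp only [edgeForce_apply, relPos_rigidMotion, act_sum, act_smul]

theorem mismatchForce_rigidMotion (G : SensingGraph n r) (c : Space m)
    (Q : Matrix (Fin m) (Fin m) ℝ) (p : Fin n → Space m) (y : EuclideanSpace ℝ (Fin r))
    (i : Fin n) :
    mismatchForce G (fun i => c + act Q (p i)) y i = act Q (mismatchForce G p y i) := by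
  simp only [mismatchForce_apply, relPos_rigidMotion, act_sum, act_smul]

theorem distError_rigidMotion (G : SensingGraph n r) (pd : Fin n → Space m) (c : Space m)
    {Q : Matrix (Fin m) (Fin m) ℝ} (hQ : Qᵀ * Q = 1) (p : Fin n → Space m) :
    distError G pd (fun i => c + act Q (p i)) = distError G pd p := by
  simp only [distError, relPos_rigidMotion, norm_act hQ]

/-- The errors are quadratic in the positions, so this expansion about `pd` is exact, with
derivative `2 R`. -/
theorem distError_add (G : SensingGraph n r) (pd s : Fin n → Space m) :
    distError G pd (pd + s) = (2 : ℝ) • rigidityMap G pd s + rigidityMap G s s := by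
  ext k
  simp only [distError, relPos_add, PiLp.add_apply, PiLp.smul_apply, rigidityMap_apply,
    smul_eq_mul, norm_add_sq_real, real_inner_self_eq_norm_sq]
  ring

/-- Full row rank of the rigidity matrix means injectivity of its transpose. -/
theorem rank_rigidityMatrix_eq_iff (G : SensingGraph n r) (p : Fin n → Space m) :
    (rigidityMatrix G p).rank = r ↔ Function.Injective (edgeForce G p) := by
  have h1 : (rigidityMatrix G p).rank = r ↔ LinearIndependent ℝ (rigidityMatrix G p).row := by
    rw [linearIndependent_iff_card_eq_finrank_span, Matrix.rank_eq_finrank_span_row,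
      Fintype.card_fin, Set.finrank]
    exact eq_comm
  have h2 : ∀ y : EuclideanSpace ℝ (Fin r), ∀ i a,
      (WithLp.ofLp y ᵥ* rigidityMatrix G p) (i, a) = edgeForce G p y i a := fun y i a => by
    simp only [Matrix.vecMul, dotProduct, rigidityMatrix, edgeForce_apply]
    rw [WithLp.ofLp_sum, Finset.sum_apply]
    exact Finset.sum_congr rfl fun k _ => by simp; ring
  rw [h1, ← Matrix.vecMul_injective_iff]
  refine ⟨fun h y z hyz => ?_, fun h y z hyz => ?_⟩
  · refine WithLp.ofLp_injective 2 (h ?_)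
    ext ⟨i, a⟩
    change (WithLp.ofLp y ᵥ* rigidityMatrix G p) (i, a) = (WithLp.ofLp z ᵥ* rigidityMatrix G p) (i, a)
    rw [h2, h2, hyz]
  · have := h (a₁ := WithLp.toLp 2 y) (a₂ := WithLp.toLp 2 z) (by
      ext i a
      rw [← h2, ← h2]
      exact congrFun hyz (i, a))
    simpa using this

/-- With the edge count imposed, the rank condition becomes full row rank. -/
theorem infMinRigid_iff (G : SensingGraph n r) (p : Fin n → Space m) :
    InfMinRigid G p ↔ Function.Injective (edgeForce G p) ∧ r + m * (m + 1) / 2 = m * n := by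
  rw [← rank_rigidityMatrix_eq_iff, InfMinRigid, InfinitesimallyRigid]
  constructor <;> rintro ⟨h1, h2⟩ <;> exact ⟨by omega, h2⟩

end Linear

/-! ### Skew-symmetric matrices in dimensions two and three. -/

section Skew

/-- In dimensions two and three, skew-symmetric matrices are parametrized by `m (m - 1) / 2`
numbers, and the kernel of a nonzero one is at most a line. -/
theorem exists_skew_parametrization {m : ℕ} (hm : m = 2 ∨ m = 3) :
    ∃ (d : ℕ) (hat : (Fin d → ℝ) →ₗ[ℝ] Matrix (Fin m) (Fin m) ℝ),
      (∀ ω, (hat ω)ᵀ = -hat ω) ∧ m + d = m * (m + 1) / 2 ∧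
      ∀ ω, ω ≠ 0 → ∃ u : Space m, (m = 2 → u = 0) ∧
        ∀ x, act (hat ω) x = 0 → ∃ c : ℝ, x = c • u := by
  rcases hm with rfl | rfl
  · refine ⟨1,
      { toFun := fun ω => !![0, -ω 0; ω 0, 0]
        map_add' := fun ω ω' => by ext i j; fin_cases i <;> fin_cases j <;> simp [add_comm]
        map_smul' := fun c ω => by ext i j; fin_cases i <;> fin_cases j <;> simp },
      fun ω => by ext i j; fin_cases i <;> fin_cases j <;> simp, rfl,
      fun ω hω => ⟨0, fun _ => rfl, fun x hx => ⟨0, ?_⟩⟩⟩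
    have hω0 : ω 0 ≠ 0 := fun h => hω (by ext i; fin_cases i; exact h)
    have h0 := congrArg (fun z : Space 2 => z 0) hx
    have h1 := congrArg (fun z : Space 2 => z 1) hx
    simp [act_apply, hω0] at h0 h1
    ext i; fin_cases i <;> simp [h0, h1]
  · refine ⟨3,
      { toFun := fun ω => !![0, -ω 2, ω 1; ω 2, 0, -ω 0; -ω 1, ω 0, 0]
        map_add' := fun ω ω' => by ext i j; fin_cases i <;> fin_cases j <;> simp [add_comm]
        map_smul' := fun c ω => by ext i j; fin_cases i <;> fin_cases j <;> simp },
      fun ω => by ext i j; fin_cases i <;> fin_cases j <;> simp, rfl,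
      fun ω hω => ⟨WithLp.toLp 2 ω, by norm_num, fun x hx => ?_⟩⟩
    have h0 := congrArg (fun z : Space 3 => z 0) hx
    have h1 := congrArg (fun z : Space 3 => z 1) hx
    have h2 := congrArg (fun z : Space 3 => z 2) hx
    simp [act_apply, Fin.sum_univ_three] at h0 h1 h2
    have hs : ω 0 ^ 2 + ω 1 ^ 2 + ω 2 ^ 2 ≠ 0 := fun h => hω (by
      have a0 : ω 0 = 0 := by nlinarith [sq_nonneg (ω 0), sq_nonneg (ω 1), sq_nonneg (ω 2)]
      have a1 : ω 1 = 0 := by nlinarith [sq_nonneg (ω 0), sq_nonneg (ω 1), sq_nonneg (ω 2)]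
      have a2 : ω 2 = 0 := by nlinarith [sq_nonneg (ω 0), sq_nonneg (ω 1), sq_nonneg (ω 2)]
      ext i; fin_cases i <;> simp [a0, a1, a2])
    -- The coefficient of the orthogonal projection of `x` to the axis `ω`; the hypothesis is `ω × x
    -- = 0`.
    refine ⟨(ω 0 * x 0 + ω 1 * x 1 + ω 2 * x 2) / (ω 0 ^ 2 + ω 1 ^ 2 + ω 2 ^ 2), ?_⟩
    ext i; fin_cases i
    · simp; field_simp; linear_combination ω 2 * h1 - ω 1 * h2
    · simp; field_simp; linear_combination ω 0 * h2 - ω 2 * h0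
    · simp; field_simp; linear_combination ω 1 * h0 - ω 0 * h1

end Skew

/-! ### Splitting velocities into rigid motion and deformation. -/

section Decomposition

variable {m n r d : ℕ}

/-- In a minimally rigid framework with at least one edge, the edges are not all parallel to the
axis of an infinitesimal rotation. -/
theorem eq_zero_of_act_relPos_eq_zero {hat : (Fin d → ℝ) →ₗ[ℝ] Matrix (Fin m) (Fin m) ℝ}
    (hm : m = 2 ∨ m = 3)
    (hker : ∀ ω, ω ≠ 0 → ∃ u : Space m, (m = 2 → u = 0) ∧
      ∀ x, act (hat ω) x = 0 → ∃ c : ℝ, x = c • u)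
    {G : SensingGraph n r} {pd : Fin n → Space m} (hrigid : InfMinRigid G pd) (hr : 0 < r)
    {ω : Fin d → ℝ} (h : ∀ k, act (hat ω) (relPos G pd k) = 0) : ω = 0 := by
  by_contra hω
  obtain ⟨hinj, hcard⟩ := (infMinRigid_iff G pd).1 hrigid
  obtain ⟨u, hu2, hu⟩ := hker ω hω
  choose ζ hζ using fun k => hu _ (h k)
  -- Every edge is a multiple `ζ k` of `u`, so all forces lie on one line and the rank question
  -- becomes scalar.
  have hforce : ∀ y i, edgeForce G pd y i = (∑ k, G.incidence i k * (y k * ζ k)) • u :=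
    fun y i => by
    rw [edgeForce_apply, Finset.sum_smul]
    exact Finset.sum_congr rfl fun k _ => by rw [hζ k, smul_smul, mul_assoc]
  rcases hm with rfl | rfl
  · have h0 : EuclideanSpace.single (⟨0, hr⟩ : Fin r) (1 : ℝ) = 0 := hinj (by
      ext1 i
      rw [hforce, hforce, hu2 rfl, smul_zero, smul_zero])
    have := congrArg (fun z : EuclideanSpace ℝ (Fin r) => z ⟨0, hr⟩) h0
    simp at this
  -- The scalar forces sum to zero over the agents, so constants can be added without losing
  -- injectivity. This gives `r + 1 ≤ n`, impossible when `r = 3n - 6 > 0`.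
  · let T : (EuclideanSpace ℝ (Fin r) × ℝ) →ₗ[ℝ] (Fin n → ℝ) :=
      { toFun := fun x i => ∑ k, G.incidence i k * (x.1 k * ζ k) + x.2
        map_add' := fun x y => by
          ext i
          simp [add_mul, mul_add, Finset.sum_add_distrib]
          ring
        map_smul' := fun c x => by
          ext i
          simp only [Prod.smul_fst, Prod.smul_snd, PiLp.smul_apply, smul_eq_mul, Pi.smul_apply,
            mul_add, Finset.mul_sum, RingHom.id_apply]
          congr 1
          exact Finset.sum_congr rfl fun k _ => by ring }
    have hT : Function.Injective T := by
      rw [injective_iff_map_eq_zero]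
      rintro ⟨y, c⟩ h0
      have h1 : ∀ i, ∑ k, G.incidence i k * (y k * ζ k) + c = 0 := fun i => congrFun h0 i
      have h2 : ∑ i, ∑ k, G.incidence i k * (y k * ζ k) = 0 := by
        rw [Finset.sum_comm]
        refine Finset.sum_eq_zero fun k _ => ?_
        simpa using sum_incidence_smul G k fun _ => y k * ζ k
      have h3 : (n : ℝ) * c = 0 := by
        have := Finset.sum_eq_zero (s := Finset.univ) fun i _ => h1 i
        rw [Finset.sum_add_distrib, h2] at this
        simpa using this
      have hn : (n : ℝ) ≠ 0 := by
        have : n ≠ 0 := by omega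
        exact_mod_cast this
      have hc : c = 0 := (mul_eq_zero.1 h3).resolve_left hn
      have hy : y = 0 := hinj (by
        ext1 i
        have := h1 i
        rw [hc, add_zero] at this
        rw [hforce, this, zero_smul, map_zero, Pi.zero_apply])
      rw [hy, hc]; rfl
    have := LinearMap.finrank_le_finrank_of_injective hT
    simp at this
    omega

/-- The velocities `a + ω × b i` of a rigid motion. -/
noncomputable def rotation (hat : (Fin d → ℝ) →ₗ[ℝ] Matrix (Fin m) (Fin m) ℝ) :
    (Fin n → Space m) →ₗ[ℝ] (Fin d → ℝ) →ₗ[ℝ] (Fin n → Space m) :=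
  LinearMap.mk₂ ℝ (fun b ω i => act (hat ω) (b i))
    (fun p q y => by ext1 i; simp [act_add])
    (fun c p y => by ext1 i; simp [act_smul])
    (fun p y z => by ext1 i; simp [add_act])
    (fun c p y => by ext1 i; simp [smul_act])

theorem rotation_apply (hat : (Fin d → ℝ) →ₗ[ℝ] Matrix (Fin m) (Fin m) ℝ)
    (b : Fin n → Space m) (ω : Fin d → ℝ) (i : Fin n) :
    rotation hat b ω i = act (hat ω) (b i) := rfl

/-- The velocity of a framework `b` in the slice through `pd`, in terms of the rigid motion of the
frame and of the deformation `R(pd)ᵀ η`. -/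
noncomputable def velocityMap (hat : (Fin d → ℝ) →ₗ[ℝ] Matrix (Fin m) (Fin m) ℝ)
    (G : SensingGraph n r) (pd b : Fin n → Space m) :
    (Space m × (Fin d → ℝ) × EuclideanSpace ℝ (Fin r)) →ₗ[ℝ] (Fin n → Space m) :=
  (LinearMap.pi fun _ => LinearMap.id).coprod ((rotation hat b).coprod (edgeForce G pd))

theorem velocityMap_apply (hat : (Fin d → ℝ) →ₗ[ℝ] Matrix (Fin m) (Fin m) ℝ)
    (G : SensingGraph n r) (pd b : Fin n → Space m) (a : Space m) (ω : Fin d → ℝ)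
    (η : EuclideanSpace ℝ (Fin r)) (i : Fin n) :
    velocityMap hat G pd b (a, ω, η) i = a + (act (hat ω) (b i) + edgeForce G pd η i) := by
  simp [velocityMap, rotation_apply]

/-- Pairing `R Rᵀ η = 0` with `η` gives `|Rᵀ η|² = 0`. -/
theorem eq_zero_of_rigidityMap_edgeForce {G : SensingGraph n r} {pd : Fin n → Space m}
    (hinj : Function.Injective (edgeForce G pd)) {η : EuclideanSpace ℝ (Fin r)}
    (h : rigidityMap G pd (edgeForce G pd η) = 0) : η = 0 := by
  have h1 := dot_edgeForce G pd (edgeForce G pd η) η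
  rw [h, inner_zero_right] at h1
  exact hinj ((eq_zero_of_dot_self h1).trans (map_zero _).symm)

/-- A rotational velocity is orthogonal to each edge, so lengths do not change to first order. -/
theorem rigidityMap_rigidMotion {hat : (Fin d → ℝ) →ₗ[ℝ] Matrix (Fin m) (Fin m) ℝ}
    (hskew : ∀ ω, (hat ω)ᵀ = -hat ω) (G : SensingGraph n r) (pd : Fin n → Space m) (a : Space m)
    (ω : Fin d → ℝ) : rigidityMap G pd (fun i => a + act (hat ω) (pd i)) = 0 := by
  ext k
  rw [rigidityMap_apply, relPos_rigidMotion, inner_skew_act_self (hskew ω)]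
  rfl

/-- `R` kills the rigid part and leaves `R Rᵀ η = 0`. With `η = 0` the relative velocities determine
`ω`, and any vertex then determines `a`. -/
theorem velocityMap_injective {hat : (Fin d → ℝ) →ₗ[ℝ] Matrix (Fin m) (Fin m) ℝ}
    (hm : m = 2 ∨ m = 3) (hskew : ∀ ω, (hat ω)ᵀ = -hat ω)
    (hker : ∀ ω, ω ≠ 0 → ∃ u : Space m, (m = 2 → u = 0) ∧
      ∀ x, act (hat ω) x = 0 → ∃ c : ℝ, x = c • u)
    {G : SensingGraph n r} {pd : Fin n → Space m} (hrigid : InfMinRigid G pd) (hr : 0 < r) :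
    Function.Injective (velocityMap hat G pd pd) := by
  have hinj := ((infMinRigid_iff G pd).1 hrigid).1
  rw [injective_iff_map_eq_zero]
  rintro ⟨a, ω, η⟩ h
  have h' : (fun i => a + act (hat ω) (pd i)) + edgeForce G pd η = 0 := by
    ext1 i
    rw [← h, velocityMap_apply, Pi.add_apply, add_assoc]
  have hη : η = 0 := by
    refine eq_zero_of_rigidityMap_edgeForce hinj ?_
    have := congrArg (rigidityMap G pd) h'
    rwa [map_add, rigidityMap_rigidMotion hskew, zero_add, map_zero] at this
  rw [hη, map_zero, add_zero] at h'
  have hω : ω = 0 := eq_zero_of_act_relPos_eq_zero hm hker hrigid hr fun k => by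
    rw [← relPos_rigidMotion G a, h']
    simp [relPos]
  have ha : a = 0 := by
    have := congrFun h' (G.tail ⟨0, hr⟩)
    simpa [hω, zero_act] using this
  rw [ha, hω, hη]; rfl

/-- The dimensions match: `m + d + r = m n`. -/
theorem velocityMap_bijective {hat : (Fin d → ℝ) →ₗ[ℝ] Matrix (Fin m) (Fin m) ℝ}
    (hm : m = 2 ∨ m = 3) (hskew : ∀ ω, (hat ω)ᵀ = -hat ω) (hd : m + d = m * (m + 1) / 2)
    (hker : ∀ ω, ω ≠ 0 → ∃ u : Space m, (m = 2 → u = 0) ∧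
      ∀ x, act (hat ω) x = 0 → ∃ c : ℝ, x = c • u)
    {G : SensingGraph n r} {pd : Fin n → Space m} (hrigid : InfMinRigid G pd) (hr : 0 < r) :
    Function.Bijective (velocityMap hat G pd pd) := by
  have h := velocityMap_injective hm hskew hker hrigid hr
  refine ⟨h, (LinearMap.injective_iff_surjective_of_finrank_eq_finrank ?_).1 h⟩
  have := hrigid.2
  simp [Module.finrank_pi_fintype]
  rw [mul_comm n m]
  omega

end Decomposition

/-! ### Best alignment with the desired framework. -/

section Procrustes

variable {m n r d : ℕ}

theorem exists_dot_self_le {E : Type*} [NormedAddCommGroup E] [NormedSpace ℝ E]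
    [FiniteDimensional ℝ E] (s : E →ₗ[ℝ] (Fin n → Space m)) :
    ∃ C, 0 ≤ C ∧ ∀ x, dot (s x) (s x) ≤ C * ‖x‖ ^ 2 := by
  let B : E →L[ℝ] E →L[ℝ] ℝ := (dot.compl₁₂ s s).toContinuousBilinearMap
  refine ⟨‖B‖, by positivity, fun x => ?_⟩
  have h := (le_abs_self _).trans (B.le_opNorm₂ x x)
  have h2 : B x x = dot (s x) (s x) := rfl
  rw [← h2, sq, ← mul_assoc]
  exact h

theorem exists_le_dot_self {E : Type*} [NormedAddCommGroup E] [NormedSpace ℝ E]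
    [FiniteDimensional ℝ E] (s : E →ₗ[ℝ] (Fin n → Space m)) (hs : Function.Injective s) :
    ∃ c, 0 < c ∧ ∀ x, c * ‖x‖ ^ 2 ≤ dot (s x) (s x) := by
  let B : E →L[ℝ] E →L[ℝ] ℝ := (dot.compl₁₂ s s).toContinuousBilinearMap
  refine exists_mul_sq_norm_le (q := fun x => B x x) (by fun_prop) (fun t x => ?_) fun x hx => ?_
  · simp only [map_smul, smul_apply, smul_eq_mul]
    ring
  · exact dot_self_pos fun h => hx (hs (h.trans (map_zero s).symm))

/-- A rotation that best aligns the framework `p` with `pd` satisfies the first order condition. -/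
theorem exists_optimal_rotation {hat : (Fin d → ℝ) →ₗ[ℝ] Matrix (Fin m) (Fin m) ℝ}
    (hskew : ∀ ω, (hat ω)ᵀ = -hat ω) (p pd : Fin n → Space m) :
    ∃ Q ∈ Matrix.specialOrthogonalGroup (Fin m) ℝ,
      (∀ Q' ∈ Matrix.specialOrthogonalGroup (Fin m) ℝ,
        dot p (fun i => act Q' (pd i)) ≤ dot p (fun i => act Q (pd i))) ∧
      ∀ ω, dot p (fun i => act Q (act (hat ω) (pd i))) = 0 := by
  have hcont : Continuous fun Q : Matrix (Fin m) (Fin m) ℝ => dot p fun i => act Q (pd i) := by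
    simp only [dot_apply, inner_eq_sum, act_apply]
    refine continuous_finsetSum _ fun i _ => continuous_finsetSum _ fun a _ =>
      continuous_const.mul (continuous_finsetSum _ fun b _ => Continuous.mul ?_ continuous_const)
    exact continuous_id.matrix_elem a b
  obtain ⟨Q, hQ, hmax⟩ := isCompact_specialOrthogonalGroup.exists_isMaxOn
    ⟨1, one_mem (Matrix.specialOrthogonalGroup (Fin m) ℝ)⟩ hcont.continuousOn
  refine ⟨Q, hQ, fun Q' hQ' => hmax hQ', fun ω => ?_⟩
  -- The curve `Q * E t` stays in the rotation group and leaves `Q` in the direction `Q * hat ω`;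
  -- the alignment is maximal at `t = 0`.
  obtain ⟨E, hE0, hE⟩ := exists_frame (Ω := fun _ => hat ω) (fun _ _ => continuous_const)
    (fun _ => hskew ω) (one_mem (Matrix.specialOrthogonalGroup (Fin m) ℝ))
  have hd : HasDerivAt (fun t => dot p fun i => act Q (act (E t) (pd i)))
      (dot p fun i => act Q (act (hat ω) (pd i))) 0 := by
    simp only [dot_apply]
    refine HasDerivAt.fun_sum fun i _ => ?_
    have h1 := hasDerivAt_act (hE 0).2 (hasDerivAt_const (0 : ℝ) (pd i))
    rw [hE0, Matrix.one_mul] at h1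
    have h2 := hasDerivAt_act (Q := fun _ => Q) (Q' := 0)
      (fun i j => hasDerivAt_const (0 : ℝ) (Q i j)) h1
    have h3 := (hasDerivAt_const (0 : ℝ) (p i)).inner ℝ h2
    simpa [zero_act, one_act, hE0, act] using h3
  refine IsLocalMax.hasDerivAt_eq_zero (Eventually.of_forall fun t => ?_) hd
  have h : dot p (fun i => act (Q * E t) (pd i)) ≤ dot p (fun i => act Q (pd i)) :=
    hmax (mul_mem hQ (hE t).1)
  simpa only [act_mul, hE0, one_act] using h

/-- A framework whose relative positions are close to those of a rotated copy of `pd` is, up to a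
rigid motion, a small deformation of `pd` in the direction of the range of `R(pd)ᵀ`. -/
theorem exists_slice_representation {hat : (Fin d → ℝ) →ₗ[ℝ] Matrix (Fin m) (Fin m) ℝ}
    (hm : m = 2 ∨ m = 3) (hskew : ∀ ω, (hat ω)ᵀ = -hat ω) (hd : m + d = m * (m + 1) / 2)
    (hker : ∀ ω, ω ≠ 0 → ∃ u : Space m, (m = 2 → u = 0) ∧
      ∀ x, act (hat ω) x = 0 → ∃ c : ℝ, x = c • u)
    {G : SensingGraph n r} {pd : Fin n → Space m} (hrigid : InfMinRigid G pd) (hr : 0 < r)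
    (hcen : ∑ i, pd i = 0) :
    ∃ C, 0 ≤ C ∧ ∀ (ρ : ℝ) (p : Fin n → Space m) (Q₀ : Matrix (Fin m) (Fin m) ℝ),
      Q₀ ∈ Matrix.specialOrthogonalGroup (Fin m) ℝ →
      (∀ k, ‖relPos G p k - act Q₀ (relPos G pd k)‖ ≤ ρ) →
      ∃ Q ∈ Matrix.specialOrthogonalGroup (Fin m) ℝ, ∃ (c : Space m)
        (y : EuclideanSpace ℝ (Fin r)), ‖y‖ ≤ C * ρ ∧
        ∀ i, p i = c + act Q ((pd + edgeForce G pd y) i) := by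
  have hinj := ((infMinRigid_iff G pd).1 hrigid).1
  have hsurj := (velocityMap_bijective hm hskew hd hker hrigid hr).2
  let s : ((Fin d → ℝ) × EuclideanSpace ℝ (Fin r)) →ₗ[ℝ] (Fin n → Space m) :=
    (rotation hat pd).coprod (edgeForce G pd)
  -- Edge vectors forget only the translation, so they bound `ω` and `η` linearly.
  let Ψ : ((Fin d → ℝ) × EuclideanSpace ℝ (Fin r)) →ₗ[ℝ] (Fin r → Space m) :=
    { toFun := fun x k => relPos G (s x) k
      map_add' := fun x y => by ext1 k; rw [map_add, relPos_add]; rfl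
      map_smul' := fun c x => by ext1 k; rw [map_smul, relPos_smul]; rfl }
  have hs : ∀ ω η, s (ω, η) = (fun i => 0 + act (hat ω) (pd i)) + edgeForce G pd η :=
    fun ω η => by ext1 i; simp [s, rotation_apply]
  have hΨinj : Function.Injective Ψ := by
    rw [injective_iff_map_eq_zero]
    rintro ⟨ω, η⟩ h
    have h1 : ∀ k, relPos G (s (ω, η)) k = 0 := fun k => congrFun h k
    have hη : η = 0 := by
      refine eq_zero_of_rigidityMap_edgeForce hinj ?_
      have h2 : rigidityMap G pd (s (ω, η)) = 0 := by
        ext k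
        rw [rigidityMap_apply, h1, inner_zero_right]; rfl
      rwa [hs, map_add, rigidityMap_rigidMotion hskew, zero_add] at h2
    have hω : ω = 0 := eq_zero_of_act_relPos_eq_zero hm hker hrigid hr fun k => by
      have := h1 k
      rwa [hs, hη, map_zero, add_zero, relPos_rigidMotion] at this
    rw [hω, hη]; rfl
  obtain ⟨K, -, hK⟩ := Ψ.injective_iff_antilipschitz.1 hΨinj
  have hK' : ∀ x, ‖x‖ ≤ K * ‖Ψ x‖ := fun x => ZeroHomClass.bound_of_antilipschitz Ψ hK x
  obtain ⟨C₂, hC₂, hs₂⟩ := exists_dot_self_le s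
  obtain ⟨c₁, hc₁, hs₁⟩ := exists_le_dot_self (edgeForce G pd) hinj
  refine ⟨√(C₂ / c₁) * K, by positivity, fun ρ p Q₀ hQ₀ hp => ?_⟩
  have hρ : 0 ≤ ρ := (norm_nonneg _).trans (hp ⟨0, hr⟩)
  obtain ⟨⟨a₀, ω₀, η₀⟩, h₀⟩ := hsurj fun i => act Q₀ᵀ (p i) - pd i
  have h₀' : ∀ i, act Q₀ᵀ (p i) - pd i = a₀ + s (ω₀, η₀) i := fun i => by
    rw [← congrFun h₀ i, velocityMap_apply, hs]; simp
  have hsmall : ‖(ω₀, η₀)‖ ≤ K * ρ := by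
    refine (hK' _).trans (mul_le_mul_of_nonneg_left ?_ K.2)
    rw [pi_norm_le_iff_of_nonneg hρ]
    intro k
    have h1 : Ψ (ω₀, η₀) k = act Q₀ᵀ (relPos G p k - act Q₀ (relPos G pd k)) := by
      rw [act_sub, ← act_mul, transpose_mul_of_mem hQ₀, one_act]
      have h2 : s (ω₀, η₀) (G.tail k) - s (ω₀, η₀) (G.head k)
          = (act Q₀ᵀ (p (G.tail k)) - pd (G.tail k))
            - (act Q₀ᵀ (p (G.head k)) - pd (G.head k)) := by
        rw [h₀', h₀']; abel
      change s (ω₀, η₀) (G.tail k) - s (ω₀, η₀) (G.head k) = _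
      rw [h2, relPos, relPos, act_sub]; abel
    rw [h1, norm_act (transpose_mul_of_mem (transpose_mem hQ₀))]
    exact hp k
  -- The edges do not control `a₀`; it is removed before distances to `pd` are compared.
  let p' : Fin n → Space m := fun i => p i - act Q₀ a₀
  have hp₀ : ∀ i, act Q₀ᵀ (p' i) - pd i = s (ω₀, η₀) i := fun i => by
    have := h₀' i
    simp only [p']
    rw [act_sub, ← act_mul, transpose_mul_of_mem hQ₀, one_act, sub_right_comm, this]
    abel
  obtain ⟨Q, hQ, hmax, hopt⟩ := exists_optimal_rotation hskew p' pd
  obtain ⟨⟨a, ω, η⟩, h⟩ := hsurj fun i => act Qᵀ (p' i) - pd i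
  set q : Fin n → Space m := fun i => act Qᵀ (p' i) - pd i with hq
  have hqe : q = (fun _ => a) + rotation hat pd ω + edgeForce G pd η := by
    rw [← h]; ext1 i
    rw [velocityMap_apply]; simp [rotation_apply, add_assoc]
  have horth_const : ∀ u : Fin n → Space m, ∑ i, u i = 0 → dot (fun _ => a) u = 0 := fun u hu => by
    rw [dot_apply, ← inner_sum, hu, inner_zero_right]
  -- The first order condition makes `q` orthogonal to all rotations of `pd`. So are its translation
  -- part, `pd` being centred, and its part in the range of `Rᵀ`; hence its rotation part is
  -- orthogonal to itself.
  have hrot : rotation hat pd ω = 0 := by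
    have hr0 : rotation hat pd ω = fun i => 0 + act (hat ω) (pd i) := by
      ext1 i; simp [rotation_apply]
    have h1 : dot q (rotation hat pd ω) = 0 := by
      have h2 : ∀ i, inner ℝ (q i) (rotation hat pd ω i)
          = inner ℝ (p' i) (act Q (act (hat ω) (pd i))) := fun i => by
        rw [hq, rotation_apply, inner_sub_left, inner_skew_act_self (hskew ω), sub_zero,
          inner_act_left, Matrix.transpose_transpose]
      rw [dot_apply, Finset.sum_congr rfl fun i _ => h2 i]
      exact hopt ω
    have h3 : ∑ i, rotation hat pd ω i = 0 := by
      simp only [rotation_apply]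
      rw [← act_sum, hcen]
      ext j; simp [act_apply]
    rw [hqe, map_add, map_add, LinearMap.add_apply, LinearMap.add_apply, horth_const _ h3,
      dot_edgeForce, hr0, rigidityMap_rigidMotion hskew, inner_zero_right, zero_add,
      add_zero] at h1
    rw [hr0]
    exact eq_zero_of_dot_self h1
  rw [hrot, add_zero] at hqe
  -- Maximal alignment is minimal squared distance, so `Q` fits at least as well as `Q₀`; this
  -- bounds `η`.
  have hexp : ∀ Q' ∈ Matrix.specialOrthogonalGroup (Fin m) ℝ,
      dot (fun i => act Q'ᵀ (p' i) - pd i) (fun i => act Q'ᵀ (p' i) - pd i)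
        = dot p' p' + dot pd pd - 2 * dot p' (fun i => act Q' (pd i)) := fun Q' hQ' => by
    simp only [dot_apply, Finset.mul_sum, ← Finset.sum_add_distrib, ← Finset.sum_sub_distrib]
    refine Finset.sum_congr rfl fun i _ => ?_
    rw [inner_sub_left, inner_sub_right, inner_sub_right,
      inner_act_act (transpose_mul_of_mem (transpose_mem hQ')), real_inner_comm (act Q'ᵀ (p' i)),
      inner_act_left, Matrix.transpose_transpose]
    ring
  have hle : dot q q ≤ dot (s (ω₀, η₀)) (s (ω₀, η₀)) := by
    have h1 := hexp Q hQ
    have h2 := hexp Q₀ hQ₀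
    rw [show (fun i => act Q₀ᵀ (p' i) - pd i) = s (ω₀, η₀) from funext hp₀] at h2
    have h3 := hmax Q₀ hQ₀
    rw [← hq] at h1
    linarith
  have hge : dot (edgeForce G pd η) (edgeForce G pd η) ≤ dot q q := by
    rw [hqe, map_add, map_add, LinearMap.add_apply, LinearMap.add_apply,
      dot_comm (edgeForce G pd η) (fun _ => a), horth_const _ (sum_edgeForce G pd η)]
    have := dot_self_nonneg (fun _ : Fin n => a)
    linarith
  refine ⟨Q, hQ, act Q₀ a₀ + act Q a, η, ?_, fun i => ?_⟩
  · have h1 : c₁ * ‖η‖ ^ 2 ≤ C₂ * (K * ρ) ^ 2 :=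
      (hs₁ η).trans (hge.trans (hle.trans ((hs₂ _).trans (by gcongr))))
    refine le_of_sq_le_sq_of_nonneg ?_ (by positivity)
    rw [mul_assoc, mul_pow, Real.sq_sqrt (by positivity), div_mul_eq_mul_div, le_div_iff₀ hc₁]
    linarith
  · have h1 := congrFun hqe i
    have h2 : act Qᵀ (p' i) = a + (pd + edgeForce G pd η) i := by
      have h3 : act Qᵀ (p' i) = q i + pd i := by simp [hq]
      rw [h3, h1]
      simp only [Pi.add_apply]; abel
    have h4 : p' i = act Q (a + (pd + edgeForce G pd η) i) := by
      rw [← h2, ← act_mul, mul_transpose_of_mem hQ, one_act]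
    rw [add_assoc, ← act_add, ← h4]
    simp [p']

end Procrustes

/-! ### The reduced system, its linearization and its Lyapunov function. -/

section Reduced

variable {m n r d : ℕ}

theorem contDiffAt_bilinear {E₁ E₂ E₃ X : Type*} [NormedAddCommGroup E₁] [NormedSpace ℝ E₁]
    [FiniteDimensional ℝ E₁] [NormedAddCommGroup E₂] [NormedSpace ℝ E₂] [FiniteDimensional ℝ E₂]
    [NormedAddCommGroup E₃] [NormedSpace ℝ E₃] [NormedAddCommGroup X] [NormedSpace ℝ X]
    (B : E₁ →ₗ[ℝ] E₂ →ₗ[ℝ] E₃) {f : X → E₁} {g : X → E₂} {x : X} {k : WithTop ℕ∞}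
    (hf : ContDiffAt ℝ k f x) (hg : ContDiffAt ℝ k g x) :
    ContDiffAt ℝ k (fun x => B (f x) (g x)) x :=
  (B.toContinuousBilinearMap.contDiff.contDiffAt.comp x hf).clm_apply hg

theorem contDiffAt_linear {E₁ E₂ X : Type*} [NormedAddCommGroup E₁] [NormedSpace ℝ E₁]
    [FiniteDimensional ℝ E₁] [NormedAddCommGroup E₂] [NormedSpace ℝ E₂]
    [NormedAddCommGroup X] [NormedSpace ℝ X]
    (B : E₁ →ₗ[ℝ] E₂) {f : X → E₁} {x : X} {k : WithTop ℕ∞} (hf : ContDiffAt ℝ k f x) :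
    ContDiffAt ℝ k (fun x => B (f x)) x :=
  (LinearMap.toContinuousLinearMap B).contDiff.contDiffAt.comp x hf

/-- The difference quotient at `0` is `g` itself, so continuity of `g` is enough. -/
theorem hasDerivAt_smul_self {E : Type*} [NormedAddCommGroup E] [NormedSpace ℝ E] {g : ℝ → E}
    (hg : ContinuousAt g 0) : HasDerivAt (fun t => t • g t) (g 0) 0 := by
  rw [hasDerivAt_iff_tendsto_slope]
  refine (hg.tendsto.mono_left nhdsWithin_le_nhds).congr' ?_
  filter_upwards [self_mem_nhdsWithin] with t ht
  simp only [slope_def_module, sub_zero, zero_smul, smul_smul]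
  rw [inv_mul_cancel₀ ht, one_smul]

/-- The slice through `pd`, parametrized by `ℝ^r`. -/
noncomputable def slice (G : SensingGraph n r) (pd : Fin n → Space m)
    (y : EuclideanSpace ℝ (Fin r)) : Fin n → Space m := pd + edgeForce G pd y

/-- The map `velocityMap` along the slice. -/
noncomputable def sliceVelocity (hat : (Fin d → ℝ) →ₗ[ℝ] Matrix (Fin m) (Fin m) ℝ)
    (G : SensingGraph n r) (pd : Fin n → Space m) (y : EuclideanSpace ℝ (Fin r)) :
    (Space m × (Fin d → ℝ) × EuclideanSpace ℝ (Fin r)) →L[ℝ] (Fin n → Space m) :=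
  (velocityMap hat G pd (slice G pd y)).toContinuousLinearMap

/-- The rotation term is bilinear and the slice affine, so the dependence on `y` is affine. -/
theorem contDiff_sliceVelocity (hat : (Fin d → ℝ) →ₗ[ℝ] Matrix (Fin m) (Fin m) ℝ)
    (G : SensingGraph n r) (pd : Fin n → Space m) {k : WithTop ℕ∞} :
    ContDiff ℝ k (sliceVelocity hat G pd) := by
  let L := ((((rotation hat) ∘ₗ (edgeForce G pd)).compl₂
    (LinearMap.fst ℝ (Fin d → ℝ) (EuclideanSpace ℝ (Fin r)) ∘ₗ
      LinearMap.snd ℝ (Space m) _)) : EuclideanSpace ℝ (Fin r) →ₗ[ℝ]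
        (Space m × (Fin d → ℝ) × EuclideanSpace ℝ (Fin r)) →ₗ[ℝ]
          (Fin n → Space m)).toContinuousBilinearMap
  have h : sliceVelocity hat G pd = fun y => sliceVelocity hat G pd 0 + L y := by
    funext y
    refine ContinuousLinearMap.ext fun ⟨a, ω, η⟩ => ?_
    ext1 i
    change velocityMap hat G pd (slice G pd y) (a, ω, η) i
      = velocityMap hat G pd (slice G pd 0) (a, ω, η) i + rotation hat (edgeForce G pd y) ω i
    simp only [velocityMap_apply, slice, rotation_apply, Pi.add_apply, act_add, map_zero,
      add_zero]
    abel
  rw [h]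
  fun_prop

/-- The rigid and the deformation parts of a velocity at a point of the slice. -/
noncomputable def decomposition (hat : (Fin d → ℝ) →ₗ[ℝ] Matrix (Fin m) (Fin m) ℝ)
    (G : SensingGraph n r) (pd : Fin n → Space m) (y : EuclideanSpace ℝ (Fin r)) :
    (Fin n → Space m) →L[ℝ] (Space m × (Fin d → ℝ) × EuclideanSpace ℝ (Fin r)) :=
  (sliceVelocity hat G pd y).inverse

/-- The closed loop in the body frame, on the slice. -/
noncomputable def reducedField (hat : (Fin d → ℝ) →ₗ[ℝ] Matrix (Fin m) (Fin m) ℝ)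
    (G : SensingGraph n r) (pd : Fin n → Space m)
    (x : (EuclideanSpace ℝ (Fin r) × (Fin n → Space m)) × EuclideanSpace ℝ (Fin r)) :
    EuclideanSpace ℝ (Fin r) × (Fin n → Space m) :=
  ((decomposition hat G pd x.1.1 x.1.2).2.2,
    -x.1.2 - rotation hat x.1.2 (decomposition hat G pd x.1.1 x.1.2).2.1
      - edgeForce G (slice G pd x.1.1) (distError G pd (slice G pd x.1.1))
      - mismatchForce G (slice G pd x.1.1) x.2)

theorem slice_zero (G : SensingGraph n r) (pd : Fin n → Space m) : slice G pd 0 = pd := by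
  simp [slice]

theorem distError_slice (G : SensingGraph n r) (pd : Fin n → Space m)
    (y : EuclideanSpace ℝ (Fin r)) : distError G pd (slice G pd y)
      = (2 : ℝ) • rigidityMap G pd (edgeForce G pd y)
        + rigidityMap G (edgeForce G pd y) (edgeForce G pd y) :=
  distError_add G pd _

theorem contDiff_slice (G : SensingGraph n r) (pd : Fin n → Space m) {k : WithTop ℕ∞} :
    ContDiff ℝ k (slice G pd) :=
  contDiff_const.add (LinearMap.toContinuousLinearMap (edgeForce G pd)).contDiff

theorem contDiff_distError (G : SensingGraph n r) (pd : Fin n → Space m) {k : WithTop ℕ∞} :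
    ContDiff ℝ k (distError G pd) := by
  have h : distError G pd = fun p => rigidityMap G p p - rigidityMap G pd pd := by
    funext p; ext k
    simp only [distError, PiLp.sub_apply, rigidityMap_apply, real_inner_self_eq_norm_sq]
  rw [h]
  exact (contDiff_iff_contDiffAt.2 fun x =>
    contDiffAt_bilinear (rigidityMap G) contDiffAt_id contDiffAt_id).sub contDiff_const

theorem isInvertible_sliceVelocity_zero {hat : (Fin d → ℝ) →ₗ[ℝ] Matrix (Fin m) (Fin m) ℝ}
    {G : SensingGraph n r} {pd : Fin n → Space m}
    (hbij : Function.Bijective (velocityMap hat G pd pd)) :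
    (sliceVelocity hat G pd 0).IsInvertible := by
  refine ⟨(LinearEquiv.ofBijective _ hbij).toContinuousLinearEquiv, ?_⟩
  refine ContinuousLinearMap.ext fun x => ?_
  simp only [sliceVelocity, slice_zero]
  rfl

theorem contDiffAt_decomposition {hat : (Fin d → ℝ) →ₗ[ℝ] Matrix (Fin m) (Fin m) ℝ}
    {G : SensingGraph n r} {pd : Fin n → Space m} {y : EuclideanSpace ℝ (Fin r)}
    (hy : (sliceVelocity hat G pd y).IsInvertible) {k : WithTop ℕ∞} :
    ContDiffAt ℝ k (decomposition hat G pd) y := by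
  obtain ⟨e, he⟩ := hy
  refine ContDiffAt.comp y (g := ContinuousLinearMap.inverse) ?_
    (contDiff_sliceVelocity hat G pd).contDiffAt
  rw [← he]
  exact contDiffAt_map_inverse e

theorem sliceVelocity_decomposition {hat : (Fin d → ℝ) →ₗ[ℝ] Matrix (Fin m) (Fin m) ℝ}
    {G : SensingGraph n r} {pd : Fin n → Space m} {y : EuclideanSpace ℝ (Fin r)}
    (hy : (sliceVelocity hat G pd y).IsInvertible) (w : Fin n → Space m) (i : Fin n) :
    (decomposition hat G pd y w).1 + (act (hat (decomposition hat G pd y w).2.1)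
      (slice G pd y i) + edgeForce G pd (decomposition hat G pd y w).2.2 i) = w i := by
  rw [← velocityMap_apply]
  obtain ⟨e, he⟩ := hy
  have h : sliceVelocity hat G pd y (decomposition hat G pd y w) = w := by
    rw [decomposition, ← he, ContinuousLinearMap.inverse_equiv]
    simp
  exact congrFun h i

theorem contDiffAt_reducedField {hat : (Fin d → ℝ) →ₗ[ℝ] Matrix (Fin m) (Fin m) ℝ}
    {G : SensingGraph n r} {pd : Fin n → Space m}
    (h0 : (sliceVelocity hat G pd 0).IsInvertible) {k : WithTop ℕ∞} :
    ContDiffAt ℝ k (reducedField hat G pd) 0 := by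
  have hy : ContDiffAt ℝ k (fun x : (EuclideanSpace ℝ (Fin r) × (Fin n → Space m)) ×
      EuclideanSpace ℝ (Fin r) => x.1.1) 0 := by fun_prop
  have hw : ContDiffAt ℝ k (fun x : (EuclideanSpace ℝ (Fin r) × (Fin n → Space m)) ×
      EuclideanSpace ℝ (Fin r) => x.1.2) 0 := by fun_prop
  have hD : ContDiffAt ℝ k (fun x : (EuclideanSpace ℝ (Fin r) × (Fin n → Space m)) ×
      EuclideanSpace ℝ (Fin r) => decomposition hat G pd x.1.1 x.1.2) 0 :=
    (ContDiffAt.comp (g := decomposition hat G pd) (0 : (EuclideanSpace ℝ (Fin r) × (Fin n → Space m)) ×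
      EuclideanSpace ℝ (Fin r)) (contDiffAt_decomposition h0) hy).clm_apply hw
  have hs : ContDiffAt ℝ k (fun x : (EuclideanSpace ℝ (Fin r) × (Fin n → Space m)) ×
      EuclideanSpace ℝ (Fin r) => slice G pd x.1.1) 0 :=
    (contDiff_slice G pd).contDiffAt.comp _ hy
  refine ContDiffAt.prodMk (by fun_prop) (((ContDiffAt.sub (by fun_prop) ?_).sub ?_).sub ?_)
  · exact contDiffAt_bilinear (rotation hat) hw (by fun_prop)
  · exact contDiffAt_bilinear (edgeForce G) hs ((contDiff_distError G pd).contDiffAt.comp _ hs)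
  · exact contDiffAt_bilinear (mismatchForce G) hs (by fun_prop)

theorem reducedField_zero (hat : (Fin d → ℝ) →ₗ[ℝ] Matrix (Fin m) (Fin m) ℝ)
    (G : SensingGraph n r) (pd : Fin n → Space m) : reducedField hat G pd 0 = 0 := by
  simp [reducedField, distError_slice]

/-- The linearization of the reduced field at the desired shape. -/
theorem fderiv_reducedField {hat : (Fin d → ℝ) →ₗ[ℝ] Matrix (Fin m) (Fin m) ℝ}
    {G : SensingGraph n r} {pd : Fin n → Space m}
    (h0 : (sliceVelocity hat G pd 0).IsInvertible) (y : EuclideanSpace ℝ (Fin r))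
    (w : Fin n → Space m) :
    fderiv ℝ (reducedField hat G pd) 0 ((y, w), 0) = ((decomposition hat G pd 0 w).2.2,
      -w - edgeForce G pd ((2 : ℝ) • rigidityMap G pd (edgeForce G pd y))) := by
  -- On the ray through `(y, w)` the field is exactly `t • g t`, so its derivative is `g 0` and no
  -- derivative of the inverse in `decomposition` has to be computed.
  let g : ℝ → EuclideanSpace ℝ (Fin r) × (Fin n → Space m) := fun t =>
    ((decomposition hat G pd (t • y) w).2.2,
      -w - t • rotation hat w (decomposition hat G pd (t • y) w).2.1
        - edgeForce G (slice G pd (t • y)) ((2 : ℝ) • rigidityMap G pd (edgeForce G pd y)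
          + t • rigidityMap G (edgeForce G pd y) (edgeForce G pd y)))
  have hF : ∀ t : ℝ, reducedField hat G pd (t • ((y, w), 0)) = t • g t := fun t => by
    simp only [reducedField, g, Prod.smul_mk, smul_zero, map_zero, sub_zero, distError_slice,
      map_smul, Prod.smul_snd, Prod.smul_fst, LinearMap.smul_apply, smul_sub, smul_neg, smul_add,
      map_add, Prod.mk.injEq, true_and]
    simp only [smul_smul, mul_comm]
  have hD : ContinuousAt (fun t : ℝ => decomposition hat G pd (t • y)) 0 := by
    refine ContinuousAt.comp (g := decomposition hat G pd) ?_ (by fun_prop)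
    rw [zero_smul]
    exact (contDiffAt_decomposition (k := 0) h0).continuousAt
  have hDw : ContinuousAt (fun t : ℝ => decomposition hat G pd (t • y) w) 0 :=
    hD.clm_apply continuousAt_const
  have hg : ContinuousAt g 0 := by
    refine ContinuousAt.prodMk (by fun_prop) ((ContinuousAt.sub (by fun_prop)
      (continuousAt_id.smul ?_)).sub ?_)
    · exact ((rotation hat w).continuous_of_finiteDimensional.continuousAt).comp
        (f := fun t : ℝ => (decomposition hat G pd (t • y) w).2.1) (by fun_prop)
    · refine (contDiffAt_bilinear (k := 0) (edgeForce G)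
        ((contDiff_slice G pd).contDiffAt.comp 0 ?_) ?_).continuousAt
      · exact contDiffAt_id.smul contDiffAt_const
      · exact contDiffAt_const.add (contDiffAt_id.smul contDiffAt_const)
  have h1 := hasDerivAt_smul_self hg
  have h2 : HasDerivAt (fun t : ℝ => reducedField hat G pd (t • ((y, w), 0)))
      (fderiv ℝ (reducedField hat G pd) 0 ((y, w), 0)) 0 := by
    have h3 : HasDerivAt (fun t : ℝ => t • ((y, w), (0 : EuclideanSpace ℝ (Fin r))))
        ((y, w), 0) 0 := by
      simpa using (hasDerivAt_id (0 : ℝ)).smul_const ((y, w), (0 : EuclideanSpace ℝ (Fin r)))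
    refine HasFDerivAt.comp_hasDerivAt (l := reducedField hat G pd) (0 : ℝ) ?_ h3
    rw [zero_smul]
    exact ((contDiffAt_reducedField (k := 1) h0).differentiableAt one_ne_zero).hasFDerivAt
  simp only [hF] at h2
  rw [h2.unique h1]
  simp [g, slice_zero]

/-- The rigid part of `w` does not stretch the edges to first order. -/
theorem rigidityMap_decomposition {hat : (Fin d → ℝ) →ₗ[ℝ] Matrix (Fin m) (Fin m) ℝ}
    (hskew : ∀ ω, (hat ω)ᵀ = -hat ω) {G : SensingGraph n r} {pd : Fin n → Space m}
    (h0 : (sliceVelocity hat G pd 0).IsInvertible) (w : Fin n → Space m) :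
    rigidityMap G pd (edgeForce G pd (decomposition hat G pd 0 w).2.2) = rigidityMap G pd w := by
  have h : w = (fun i => (decomposition hat G pd 0 w).1
      + act (hat (decomposition hat G pd 0 w).2.1) (pd i))
      + edgeForce G pd (decomposition hat G pd 0 w).2.2 := by
    ext1 i
    have := sliceVelocity_decomposition h0 w i
    rw [slice_zero] at this
    rw [Pi.add_apply, add_assoc, this]
  conv_rhs => rw [h, map_add, rigidityMap_rigidMotion hskew, zero_add]

/-- A strict quadratic Lyapunov function for the linearized reduced field. -/
theorem exists_lyapunov {hat : (Fin d → ℝ) →ₗ[ℝ] Matrix (Fin m) (Fin m) ℝ}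
    (hskew : ∀ ω, (hat ω)ᵀ = -hat ω) {G : SensingGraph n r} {pd : Fin n → Space m}
    (hinj : Function.Injective (edgeForce G pd))
    (h0 : (sliceVelocity hat G pd 0).IsInvertible) :
    ∃ B : (EuclideanSpace ℝ (Fin r) × (Fin n → Space m)) →L[ℝ]
        (EuclideanSpace ℝ (Fin r) × (Fin n → Space m)) →L[ℝ] ℝ,
      (∀ h, h ≠ 0 → 0 < B h h) ∧ ∀ h, h ≠ 0 →
        B (fderiv ℝ (reducedField hat G pd) 0 (h, 0)) h
          + B h (fderiv ℝ (reducedField hat G pd) 0 (h, 0)) < 0 := by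
  -- `N y` is the linearized distance error at the point `y` of the slice.
  let N : EuclideanSpace ℝ (Fin r) →ₗ[ℝ] EuclideanSpace ℝ (Fin r) :=
    (2 : ℝ) • (rigidityMap G pd ∘ₗ edgeForce G pd)
  let S : (Fin n → Space m) →ₗ[ℝ] EuclideanSpace ℝ (Fin r) := rigidityMap G pd
  obtain ⟨c, hc, hcε⟩ := exists_le_dot_self (edgeForce G pd) hinj
  obtain ⟨c', hc', hc'w⟩ := exists_le_dot_self (LinearMap.id : (Fin n → Space m) →ₗ[ℝ] _)
    Function.injective_id
  obtain ⟨C, hC, hCw⟩ : ∃ C, 0 ≤ C ∧ ∀ w, ‖S w‖ ^ 2 ≤ C * dot w w := by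
    let S' := LinearMap.toContinuousLinearMap S
    refine ⟨‖S'‖ ^ 2 / c', by positivity, fun w => ?_⟩
    have h1 : ‖S w‖ ≤ ‖S'‖ * ‖w‖ := S'.le_opNorm w
    have h2 : ‖w‖ ^ 2 ≤ dot w w / c' := by
      rw [le_div_iff₀ hc', mul_comm]
      exact hc'w w
    calc ‖S w‖ ^ 2 ≤ (‖S'‖ * ‖w‖) ^ 2 := by gcongr
      _ = ‖S'‖ ^ 2 * ‖w‖ ^ 2 := by ring
      _ ≤ ‖S'‖ ^ 2 * (dot w w / c') := by gcongr
      _ = _ := by ring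
  -- The summands give `δ ≤ 1/2` and `δ C ≤ 1/2` for positivity, and `δ (2 C + C / (2 c)) ≤ 1` for
  -- the decay.
  set δ : ℝ := 1 / (2 + 2 * C + C / (2 * c)) with hδ
  have hδ0 : 0 < δ := by positivity
  have hδ1 : δ * (2 + 2 * C + C / (2 * c)) = 1 := by rw [hδ]; field_simp
  have hCc : 0 ≤ δ * (C / (2 * c)) := by positivity
  have hδC : 0 ≤ δ * C := by positivity
  have hδle : δ ≤ 1 / 2 := by nlinarith
  let In := innerₗ (EuclideanSpace ℝ (Fin r))
  let f₁ := N ∘ₗ LinearMap.fst ℝ (EuclideanSpace ℝ (Fin r)) (Fin n → Space m)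
  let f₂ := S ∘ₗ LinearMap.snd ℝ (EuclideanSpace ℝ (Fin r)) (Fin n → Space m)
  let f₃ := LinearMap.snd ℝ (EuclideanSpace ℝ (Fin r)) (Fin n → Space m)
  -- Damping dissipates only `w`; the cross term `⟨N y, S w⟩` supplies the dissipation in `y`.
  let B := (1 / 2 : ℝ) • In.compl₁₂ f₁ f₁ + dot.compl₁₂ f₃ f₃
    + (δ / 2) • (In.compl₁₂ f₁ f₂ + In.compl₁₂ f₂ f₁)
  have hB : ∀ y w y' w', B.toContinuousBilinearMap (y, w) (y', w')
      = 1 / 2 * inner ℝ (N y) (N y') + dot w w'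
        + δ / 2 * (inner ℝ (N y) (S w') + inner ℝ (S w) (N y')) := fun _ _ _ _ => rfl
  refine ⟨B.toContinuousBilinearMap, ?_, ?_⟩
  · rintro ⟨y, w⟩ hne
    rw [hB, real_inner_self_eq_norm_sq, real_inner_comm (S w) (N y)]
    have h1 := abs_real_inner_le_norm (N y) (S w)
    rw [real_inner_comm] at h1
    have h2 : |inner ℝ (S w) (N y)| ≤ (‖N y‖ ^ 2 + ‖S w‖ ^ 2) / 2 := by
      refine h1.trans ?_
      nlinarith [sq_nonneg (‖N y‖ - ‖S w‖)]
    have h3 := (abs_le.1 h2).1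
    have h4 := hCw w
    have h5 : δ * inner ℝ (S w) (N y) ≥ -(1 / 4 * ‖N y‖ ^ 2 + δ * C / 2 * dot w w) := by
      have a1 : δ * ‖N y‖ ^ 2 ≤ 1 / 2 * ‖N y‖ ^ 2 := by gcongr
      have a2 : δ * ‖S w‖ ^ 2 ≤ δ * (C * dot w w) := by gcongr
      have a3 := mul_le_mul_of_nonneg_left h3 hδ0.le
      linarith
    have hw := dot_self_nonneg w
    have h6 : δ * C / 2 * dot w w ≤ 1 / 4 * dot w w := by
      have : δ * C / 2 ≤ 1 / 4 := by linarith
      exact mul_le_mul_of_nonneg_right this hw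
    have h7 : 0 < 1 / 4 * ‖N y‖ ^ 2 + 1 / 2 * dot w w := by
      by_cases hw0 : w = 0
      · have hy : N y ≠ 0 := fun h => hne (by
          have h8 : rigidityMap G pd (edgeForce G pd y) = 0 :=
            (smul_eq_zero.1 (h : (2 : ℝ) • _ = _)).resolve_left two_ne_zero
          rw [eq_zero_of_rigidityMap_edgeForce hinj h8, hw0]; rfl)
        have : 0 < ‖N y‖ := norm_pos_iff.2 hy
        positivity
      · have := dot_self_pos hw0
        positivity
    linarith
  · rintro ⟨y, w⟩ hne
    rw [fderiv_reducedField h0]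
    change B.toContinuousBilinearMap (_, -w - edgeForce G pd (N y)) (y, w)
      + B.toContinuousBilinearMap (y, w) (_, -w - edgeForce G pd (N y)) < 0
    have hNη : N (decomposition hat G pd 0 w).2.2 = (2 : ℝ) • S w :=
      congrArg ((2 : ℝ) • ·) (rigidityMap_decomposition hskew h0 w)
    have e1 : dot (edgeForce G pd (N y)) w = inner ℝ (N y) (S w) := dot_edgeForce G pd w (N y)
    have e2 : dot (edgeForce G pd (N y)) (edgeForce G pd (N y))
        = inner ℝ (N y) (S (edgeForce G pd (N y))) := dot_edgeForce G pd _ (N y)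
    -- The exchange between `½|N y|²` and `|w|²` cancels. What remains is `-2|w|² + δ (2|S w|² - ⟨N
    -- y, S w⟩ - |Rᵀ N y|²)`.
    rw [hB, hB, hNη]
    simp only [map_sub, map_neg, LinearMap.sub_apply, LinearMap.neg_apply, inner_sub_left,
      inner_sub_right, inner_neg_left, inner_neg_right, real_inner_smul_left,
      real_inner_smul_right, real_inner_self_eq_norm_sq]
    rw [dot_comm w (edgeForce G pd (N y)), e1, real_inner_comm (N y) (S w),
      real_inner_comm (N y) (S (edgeForce G pd (N y))), ← e2]
    have h1 := abs_real_inner_le_norm (N y) (S w)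
    have h2 : |inner ℝ (N y) (S w)| ≤ c / 2 * ‖N y‖ ^ 2 + ‖S w‖ ^ 2 / (2 * c) := by
      refine h1.trans ?_
      have : c / 2 * ‖N y‖ ^ 2 + ‖S w‖ ^ 2 / (2 * c) - ‖N y‖ * ‖S w‖
          = (c * ‖N y‖ - ‖S w‖) ^ 2 / (2 * c) := by field_simp; ring
      have h3 : 0 ≤ (c * ‖N y‖ - ‖S w‖) ^ 2 / (2 * c) := by positivity
      linarith
    have h3 := (abs_le.1 h2).1
    have h4 := hCw w
    have h5 := hcε (N y)
    have hw := dot_self_nonneg w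
    have a1 : δ * ‖S w‖ ^ 2 ≤ δ * (C * dot w w) := by gcongr
    have a2 : δ * (‖S w‖ ^ 2 / (2 * c)) ≤ δ * (C * dot w w / (2 * c)) := by gcongr
    have a3 := mul_le_mul_of_nonneg_left h3 hδ0.le
    have a4 := mul_le_mul_of_nonneg_left h5 hδ0.le
    have a5 : δ * (C * dot w w / (2 * c)) + 2 * (δ * (C * dot w w)) ≤ dot w w := by
      have : δ * (C * dot w w / (2 * c)) + 2 * (δ * (C * dot w w)) = (1 - 2 * δ) * dot w w := by
        rw [← hδ1]; ring
      rw [this]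
      nlinarith
    have h7 : 0 < δ * (c / 2 * ‖N y‖ ^ 2) + dot w w := by
      by_cases hw0 : w = 0
      · have hy : N y ≠ 0 := fun h => hne (by
          have h8 : rigidityMap G pd (edgeForce G pd y) = 0 :=
            (smul_eq_zero.1 (h : (2 : ℝ) • _ = _)).resolve_left two_ne_zero
          rw [eq_zero_of_rigidityMap_edgeForce hinj h8, hw0]; rfl)
        have : 0 < ‖N y‖ := norm_pos_iff.2 hy
        positivity
      · have := dot_self_pos hw0
        positivity
    linarith

end Reduced

/-! ### The limit statement and uniqueness of solutions. -/

section Conclusion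

variable {m n r d : ℕ}

/-- The motion `(p, v)` converges to a steady rigid motion of a rigid framework whose distance
errors are `eStar`. -/
def ConvergesToSteadyMotion (G : SensingGraph n r) (pd : Fin n → Space m)
    (eStar : EuclideanSpace ℝ (Fin r)) (p v : ℝ → Fin n → Space m) : Prop :=
  Tendsto (fun t => distError G pd (p t)) atTop (𝓝 eStar) ∧
    ∃ (b : Fin n → Space m) (Ω : Matrix (Fin m) (Fin m) ℝ)
      (vc : Space m) (pStar vStar : ℝ → Fin n → Space m),
      InfMinRigid G b ∧ distError G pd b = eStar ∧ IsSteadyMotion b Ω vc pStar vStar ∧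
      (∀ i j, Tendsto (fun t => (p t i - p t j) - (pStar t i - pStar t j)) atTop (𝓝 0)) ∧
      ∀ i, Tendsto (fun t => v t i - vStar t i) atTop (𝓝 0)

theorem ConvergesToSteadyMotion.congr {G : SensingGraph n r} {pd : Fin n → Space m}
    {eStar : EuclideanSpace ℝ (Fin r)} {p v p' v' : ℝ → Fin n → Space m}
    (h : ConvergesToSteadyMotion G pd eStar p v) (hp : ∀ t, 0 ≤ t → p t = p' t)
    (hv : ∀ t, 0 ≤ t → v t = v' t) : ConvergesToSteadyMotion G pd eStar p' v' := by
  obtain ⟨he, b, Ω, vc, pStar, vStar, hb, hbe, hs, h1, h2⟩ := h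
  have hev : ∀ᶠ t : ℝ in atTop, 0 ≤ t := eventually_ge_atTop 0
  refine ⟨he.congr' (hev.mono fun t ht => by simp only [hp t ht]), b, Ω, vc, pStar, vStar, hb, hbe,
    hs, fun i j => (h1 i j).congr' (hev.mono fun t ht => by simp only [hp t ht]),
    fun i => (h2 i).congr' (hev.mono fun t ht => by simp only [hv t ht])⟩

theorem IsSolution.unique {G : SensingGraph n r} {pd : Fin n → Space m}
    {μ : EuclideanSpace ℝ (Fin r)} {p v p' v' : ℝ → Fin n → Space m}
    (h : IsSolution G pd μ p v) (h' : IsSolution G pd μ p' v') (hp : p 0 = p' 0)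
    (hv : v 0 = v' 0) {t : ℝ} (ht : 0 ≤ t) : p t = p' t ∧ v t = v' t := by
  let f : (Fin n → Space m) × (Fin n → Space m) → (Fin n → Space m) × (Fin n → Space m) :=
    fun x => (x.2, control G pd μ x.1 x.2)
  have hf : ContDiff ℝ 1 f := by
    refine contDiff_snd.prodMk (contDiff_iff_contDiffAt.2 fun x => ?_)
    simp only [control_eq]
    refine (contDiffAt_snd.neg.sub ?_).sub ?_
    · exact contDiffAt_bilinear (edgeForce G) contDiffAt_fst
        ((contDiff_distError G pd).contDiffAt.comp x contDiffAt_fst)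
    · exact contDiffAt_bilinear (mismatchForce G) contDiffAt_fst contDiffAt_const
  have := solution_unique hf (α := fun t => (p t, v t)) (β := fun t => (p' t, v' t))
    (fun t ht => (h.pos t ht).prodMk (h.vel t ht))
    (fun t ht => (h'.pos t ht).prodMk (h'.vel t ht)) (by rw [hp, hv]) t ht
  exact ⟨congrArg Prod.fst this, congrArg Prod.snd this⟩

/-- To know the limit behaviour of all solutions it suffices to exhibit one. -/
theorem forall_solution_of_exists {G : SensingGraph n r} {pd : Fin n → Space m}
    {μ eStar : EuclideanSpace ℝ (Fin r)} {p₀ v₀ : Fin n → Space m}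
    (h : ∃ p v, (IsSolution G pd μ p v ∧ p 0 = p₀ ∧ v 0 = v₀) ∧
      ConvergesToSteadyMotion G pd eStar p v) :
    (∃ p v, IsSolution G pd μ p v ∧ p 0 = p₀ ∧ v 0 = v₀) ∧
      ∀ p v, IsSolution G pd μ p v → p 0 = p₀ → v 0 = v₀ →
        ConvergesToSteadyMotion G pd eStar p v := by
  obtain ⟨p, v, ⟨hs, hp, hv⟩, hc⟩ := h
  refine ⟨⟨p, v, hs, hp, hv⟩, fun p' v' hs' hp' hv' => hc.congr (fun t ht => ?_) fun t ht => ?_⟩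
  · exact (IsSolution.unique hs hs' (hp.trans hp'.symm) (hv.trans hv'.symm) ht).1
  · exact (IsSolution.unique hs hs' (hp.trans hp'.symm) (hv.trans hv'.symm) ht).2

end Conclusion

/-! ### The degenerate case without edges. -/

section NoEdges

/-- In the main theorem this happens only for `m = 3`, `n = 2`, where rotations about the line of
the two agents spoil transversality. The system is just `v' = -v`: each agent comes to rest at `p₀ i
+ v₀ i`. -/
theorem exists_solution_of_no_edges {m n : ℕ} {G : SensingGraph n 0} {pd : Fin n → Space m}
    (hrigid : InfMinRigid G pd) (hn : n ≠ 0) (μ : EuclideanSpace ℝ (Fin 0))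
    (p₀ v₀ : Fin n → Space m) :
    ∃ p v, (IsSolution G pd μ p v ∧ p 0 = p₀ ∧ v 0 = v₀) ∧
      ConvergesToSteadyMotion G pd 0 p v := by
  have hexp : ∀ t : ℝ, HasDerivAt (fun t => Real.exp (-t)) (-Real.exp (-t)) t := fun t => by
    simpa using (hasDerivAt_neg t).exp
  have hlim : Tendsto (fun t : ℝ => Real.exp (-t)) atTop (𝓝 0) :=
    Real.tendsto_exp_neg_atTop_nhds_zero
  let q : Fin n → Space m := fun i => p₀ i + v₀ i
  let c : Space m := (n : ℝ)⁻¹ • ∑ i, q i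
  refine ⟨fun t => p₀ + (1 - Real.exp (-t)) • v₀, fun t => Real.exp (-t) • v₀,
    ⟨⟨fun t _ => ?_, fun t _ => ?_⟩, by simp, by simp⟩, ?_, fun i => q i - c, 0, 0,
    fun _ i => q i - c, fun _ _ => 0, ?_, Subsingleton.elim _ _, ⟨?_, by simp, fun _ => 1,
      fun _ => 0, fun t => ⟨one_mem _, fun i j => ?_, ?_, fun i => ⟨?_, ?_⟩⟩⟩,
    fun i j => ?_, fun i => ?_⟩
  · have := (((hexp t).const_sub 1).smul_const v₀).const_add p₀
    rw [neg_neg] at this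
    exact this.hasDerivWithinAt
  · have := (hexp t).smul_const v₀
    have hc : control G pd μ (p₀ + (1 - Real.exp (-t)) • v₀) (Real.exp (-t) • v₀)
        = -Real.exp (-t) • v₀ := by
      ext1 i; simp [Formation.control]
    rw [hc]
    exact this.hasDerivWithinAt
  · exact tendsto_nhds_of_eventually_eq (Eventually.of_forall fun _ => Subsingleton.elim _ _)
  · exact (infMinRigid_iff _ _).2 ⟨Function.injective_of_subsingleton _, hrigid.2⟩
  · have hn' : (n : ℝ) ≠ 0 := by exact_mod_cast hn
    rw [Finset.sum_sub_distrib, Finset.sum_const, Finset.card_univ, Fintype.card_fin,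
      ← Nat.cast_smul_eq_nsmul ℝ, smul_smul, mul_inv_cancel₀ hn', one_smul, sub_self]
  · simpa using hasDerivAt_const t _
  · simpa [act] using hasDerivAt_const t (0 : Space m)
  · simp [one_act]
  · simp [act]
  · have h1 : ∀ t : ℝ, (p₀ + (1 - Real.exp (-t)) • v₀) i - (p₀ + (1 - Real.exp (-t)) • v₀) j
        - (q i - c - (q j - c)) = Real.exp (-t) • (v₀ j - v₀ i) := fun t => by
      simp only [Pi.add_apply, Pi.smul_apply, q]
      module
    simp_rw [h1]
    simpa using hlim.smul_const (v₀ j - v₀ i)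
  · simpa using hlim.smul_const (v₀ i)

end NoEdges

/-! ### From the reduced system back to physical space. -/

section Reconstruction

variable {m n r d : ℕ}

/-- A trajectory of the reduced field, together with the motion of the body frame, gives a solution
of the closed loop. -/
theorem hasDerivAt_reconstruction {hat : (Fin d → ℝ) →ₗ[ℝ] Matrix (Fin m) (Fin m) ℝ}
    {G : SensingGraph n r} {pd : Fin n → Space m} {μ : EuclideanSpace ℝ (Fin r)}
    {x : ℝ → EuclideanSpace ℝ (Fin r) × (Fin n → Space m)} {Q : ℝ → Matrix (Fin m) (Fin m) ℝ}
    {c : ℝ → Space m} {t : ℝ} (hinv : (sliceVelocity hat G pd (x t).1).IsInvertible)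
    (hx : HasDerivAt x (reducedField hat G pd (x t, μ)) t)
    (hQt : Q t ∈ Matrix.specialOrthogonalGroup (Fin m) ℝ)
    (hQ : ∀ i j, HasDerivAt (fun τ => Q τ i j)
      ((Q t * hat (decomposition hat G pd (x t).1 (x t).2).2.1) i j) t)
    (hc : HasDerivAt c (act (Q t) (decomposition hat G pd (x t).1 (x t).2).1) t) :
    HasDerivAt (fun τ i => c τ + act (Q τ) (slice G pd (x τ).1 i))
      (fun i => act (Q t) ((x t).2 i)) t ∧
    HasDerivAt (fun τ i => act (Q τ) ((x τ).2 i))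
      (control G pd μ (fun i => c t + act (Q t) (slice G pd (x t).1 i))
        (fun i => act (Q t) ((x t).2 i))) t := by
  set D := decomposition hat G pd (x t).1 (x t).2 with hD
  have hx1 : HasDerivAt (fun τ => (x τ).1) D.2.2 t :=
    (hasFDerivAt_fst (𝕜 := ℝ) (p := x t)).comp_hasDerivAt t hx
  have hx2 : HasDerivAt (fun τ => (x τ).2) (reducedField hat G pd (x t, μ)).2 t :=
    (hasFDerivAt_snd (𝕜 := ℝ) (p := x t)).comp_hasDerivAt t hx
  have hb : HasDerivAt (fun τ => slice G pd (x τ).1) (edgeForce G pd D.2.2) t :=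
    (show HasDerivAt (fun τ => edgeForce G pd (x τ).1) (edgeForce G pd D.2.2) t from
      (LinearMap.toContinuousLinearMap (edgeForce G pd)).hasFDerivAt.comp_hasDerivAt
        t hx1).const_add pd
  refine ⟨hasDerivAt_pi.2 fun i => ?_, hasDerivAt_pi.2 fun i => ?_⟩
  · have h := hc.add (hasDerivAt_act hQ (hasDerivAt_pi.1 hb i))
    rw [act_mul, ← act_add, ← act_add, hD, sliceVelocity_decomposition hinv] at h
    exact h
  · have h := hasDerivAt_act hQ (hasDerivAt_pi.1 hx2 i)
    -- The turning frame contributes `Q ω w`, which cancels the `rotation` term of the reduced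
    -- field.
    have heq : act (Q t * hat D.2.1) ((x t).2 i) + act (Q t) ((reducedField hat G pd (x t, μ)).2 i)
        = control G pd μ (fun i => c t + act (Q t) (slice G pd (x t).1 i))
          (fun i => act (Q t) ((x t).2 i)) i := by
      rw [control_eq, distError_rigidMotion G pd _ (transpose_mul_of_mem hQt), Pi.sub_apply,
        Pi.sub_apply, Pi.neg_apply, edgeForce_rigidMotion, mismatchForce_rigidMotion, act_mul,
        ← act_add, ← act_neg, ← act_sub, ← act_sub]
      congr 1
      simp only [reducedField, Pi.sub_apply, Pi.neg_apply, rotation_apply, ← hD]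
      abel
    rwa [heq] at h

/-- The frames themselves may rotate forever: `Q` being isometric handles `u - ue`, and the
difference of the frames handles `ue`. -/
theorem tendsto_act_sub_act {Q Qe : ℝ → Matrix (Fin m) (Fin m) ℝ} {u : ℝ → Space m}
    {ue : Space m} (hQ : ∀ t, Q t ∈ Matrix.specialOrthogonalGroup (Fin m) ℝ)
    (hQe : ∀ i j, Tendsto (fun t => Q t i j - Qe t i j) atTop (𝓝 0))
    (hu : Tendsto u atTop (𝓝 ue)) :
    Tendsto (fun t => act (Q t) (u t) - act (Qe t) ue) atTop (𝓝 0) := by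
  have h1 : ∀ t, act (Q t) (u t) - act (Qe t) ue
      = act (Q t) (u t - ue) + act (Q t - Qe t) ue := fun t => by
    rw [act_sub, sub_eq_add_neg (Q t), add_act, ← neg_one_smul ℝ (Qe t), smul_act]
    module
  simp_rw [h1]
  have h2 : Tendsto (fun t => act (Q t - Qe t) ue) atTop (𝓝 0) := by
    have := tendsto_act (Q := fun t => Q t - Qe t) (Q' := 0) hQe
      (tendsto_const_nhds (x := ue))
    rwa [zero_act] at this
  have h3 : Tendsto (fun t => act (Q t) (u t - ue)) atTop (𝓝 0) := by
    rw [tendsto_zero_iff_norm_tendsto_zero]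
    simp only [norm_act (transpose_mul_of_mem (hQ _))]
    simpa using (hu.sub_const ue).norm
  simpa using h3.add h2

theorem exists_hasDerivAt_eq {E : Type*} [NormedAddCommGroup E] [NormedSpace ℝ E]
    [CompleteSpace E] {f : ℝ → E} (hf : Continuous f) (c₀ : E) :
    ∃ c : ℝ → E, c 0 = c₀ ∧ ∀ t, HasDerivAt c (f t) t :=
  ⟨fun t => c₀ + ∫ s in (0 : ℝ)..t, f s, by simp, fun t =>
    (intervalIntegral.integral_hasDerivAt_right (hf.intervalIntegrable _ _)
      (hf.stronglyMeasurableAtFilter _ _) hf.continuousAt).const_add c₀⟩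

theorem continuous_act {Q : ℝ → Matrix (Fin m) (Fin m) ℝ} {u : ℝ → Space m}
    (hQ : ∀ i j, Continuous fun t => Q t i j) (hu : Continuous u) :
    Continuous fun t => act (Q t) (u t) :=
  continuous_iff_continuousAt.2 fun t =>
    tendsto_act (fun i j => (hQ i j).tendsto t) (hu.tendsto t)

/-- The steady motion determined by an equilibrium of the reduced field, and the convergence to it
of the trajectories which converge exponentially in the reduced space. -/
theorem exists_solution_of_reduced {hat : (Fin d → ℝ) →ₗ[ℝ] Matrix (Fin m) (Fin m) ℝ}
    (hskew : ∀ ω, (hat ω)ᵀ = -hat ω) {G : SensingGraph n r} {pd : Fin n → Space m}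
    (hcen : ∑ i, pd i = 0) {μ : EuclideanSpace ℝ (Fin r)} {R C l : ℝ} (hl : 0 < l)
    (hinv : ∀ y, ‖y‖ ≤ R → (sliceVelocity hat G pd y).IsInvertible)
    (hrig : ∀ y, ‖y‖ ≤ R → InfMinRigid G (slice G pd y))
    {xe : EuclideanSpace ℝ (Fin r) × (Fin n → Space m)} (hxe : ‖xe‖ ≤ R)
    (hFxe : reducedField hat G pd (xe, μ) = 0)
    {x : ℝ → EuclideanSpace ℝ (Fin r) × (Fin n → Space m)}
    (hx : ∀ t, 0 ≤ t → HasDerivAt x (reducedField hat G pd (x t, μ)) t ∧ ‖x t‖ ≤ R ∧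
      ‖x t - xe‖ ≤ C * Real.exp (-l * t))
    {Q₀ : Matrix (Fin m) (Fin m) ℝ} (hQ₀ : Q₀ ∈ Matrix.specialOrthogonalGroup (Fin m) ℝ)
    (c₀ : Space m) :
    ∃ p v, (IsSolution G pd μ p v ∧ p 0 = (fun i => c₀ + act Q₀ (slice G pd (x 0).1 i)) ∧
      v 0 = fun i => act Q₀ ((x 0).2 i)) ∧
      ConvergesToSteadyMotion G pd (distError G pd (slice G pd xe.1)) p v := by
  have hfst : ∀ z : EuclideanSpace ℝ (Fin r) × (Fin n → Space m), ‖z‖ ≤ R → ‖z.1‖ ≤ R :=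
    fun z hz => (norm_fst_le z).trans hz
  have hdec : ∀ z : EuclideanSpace ℝ (Fin r) × (Fin n → Space m), ‖z‖ ≤ R →
      ContDiffAt ℝ 1 (fun z : EuclideanSpace ℝ (Fin r) × (Fin n → Space m) =>
        decomposition hat G pd z.1 z.2) z := fun z hz =>
    (ContDiffAt.comp (g := decomposition hat G pd) z
      (contDiffAt_decomposition (hinv z.1 (hfst z hz))) contDiffAt_fst).clm_apply contDiffAt_snd
  -- Frozen at the initial value for negative times, because the frame is integrated over all of
  -- `ℝ`.
  let x' : ℝ → EuclideanSpace ℝ (Fin r) × (Fin n → Space m) := fun t => x (max t 0)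
  have hx'R : ∀ t, ‖x' t‖ ≤ R := fun t => (hx _ (le_max_right _ _)).2.1
  have hx'c : Continuous x' := continuous_iff_continuousAt.2 fun t =>
    ContinuousAt.comp (g := x) (hx _ (le_max_right _ _)).1.continuousAt (by fun_prop)
  have hx' : ∀ t, 0 ≤ t → x' t = x t := fun t ht => by simp only [x', max_eq_left ht]
  let D : ℝ → Space m × (Fin d → ℝ) × EuclideanSpace ℝ (Fin r) := fun t =>
    decomposition hat G pd (x' t).1 (x' t).2
  have hDc : Continuous D := continuous_iff_continuousAt.2 fun t =>
    ContinuousAt.comp (g := fun z : EuclideanSpace ℝ (Fin r) × (Fin n → Space m) =>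
      decomposition hat G pd z.1 z.2) (hdec _ (hx'R t)).continuousAt hx'c.continuousAt
  let entry : Fin m → Fin m → (Fin d → ℝ) →ₗ[ℝ] ℝ := fun i j =>
    (Matrix.entryLinearMap ℝ ℝ i j) ∘ₗ hat
  have hΩc : ∀ i j, Continuous fun t => hat (D t).2.1 i j := fun i j =>
    (entry i j).continuous_of_finiteDimensional.comp (by fun_prop : Continuous fun t => (D t).2.1)
  obtain ⟨Q, hQ0, hQ⟩ := exists_frame hΩc (fun t => hskew _) hQ₀
  have hQc : ∀ i j, Continuous fun t => Q t i j := fun i j =>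
    continuous_iff_continuousAt.2 fun t => ((hQ t).2 i j).continuousAt
  obtain ⟨c, hc0, hc⟩ := exists_hasDerivAt_eq
    (continuous_act hQc (by fun_prop : Continuous fun t => (D t).1)) c₀
  have hDx : ∀ t, 0 ≤ t → D t = decomposition hat G pd (x t).1 (x t).2 := fun t ht => by
    simp only [D, hx' t ht]
  have hrec : ∀ t : ℝ, 0 ≤ t → _ := fun t ht => hasDerivAt_reconstruction (Q := Q) (c := c)
    (hinv _ (hfst _ (hx t ht).2.1)) (hx t ht).1 (hQ t).1 (by
      rw [← hDx t ht]; exact (hQ t).2) (by rw [← hDx t ht]; exact hc t)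
  have hxlim : Tendsto x atTop (𝓝 xe) := by
    rw [tendsto_iff_norm_sub_tendsto_zero]
    have h1 : Tendsto (fun t : ℝ => C * Real.exp (-l * t)) atTop (𝓝 0) := by
      have h2 : Tendsto (fun t : ℝ => Real.exp (-l * t)) atTop (𝓝 0) :=
        Real.tendsto_exp_atBot.comp ((tendsto_const_mul_atBot_of_neg (by linarith)).2 tendsto_id)
      simpa using h2.const_mul C
    exact squeeze_zero' (Eventually.of_forall fun _ => norm_nonneg _)
      ((eventually_ge_atTop 0).mono fun t ht => (hx t ht).2.2) h1
  set De := decomposition hat G pd xe.1 xe.2 with hDe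
  let ang : EuclideanSpace ℝ (Fin r) × (Fin n → Space m) → Fin m → Fin m → ℝ := fun z i j =>
    entry i j (decomposition hat G pd z.1 z.2).2.1
  -- A Lipschitz bound passes the exponential rate from `x` to the angular velocity, as the
  -- asymptotic phase requires.
  obtain ⟨K, hK⟩ : ∃ K, LipschitzOnWith K ang (Metric.closedBall 0 R) := by
    refine LocallyLipschitzOn.exists_lipschitzOnWith_of_compact (isCompact_closedBall _ _)
      fun z hz => ?_
    have hang : ContDiffAt ℝ 1 ang z := contDiffAt_pi.2 fun i => contDiffAt_pi.2 fun j =>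
      contDiffAt_linear (entry i j) (hdec z (by simpa using hz)).snd.fst
    obtain ⟨K, s, hs, hK⟩ := hang.exists_lipschitzOnWith
    exact ⟨K, s, mem_nhdsWithin_of_mem_nhds hs, hK⟩
  have hΩlim : ∀ t, 0 ≤ t → ∀ i j, |hat (D t).2.1 i j - hat De.2.1 i j|
      ≤ K * C * Real.exp (-l * t) := fun t ht i j => by
    have h1 := hK.dist_le_mul (x t) (by simpa using (hx t ht).2.1) xe (by simpa using hxe)
    rw [dist_eq_norm, dist_eq_norm] at h1
    have h2 : |ang (x t) i j - ang xe i j| ≤ ‖ang (x t) - ang xe‖ :=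
      (norm_le_pi_norm ((ang (x t) - ang xe) i) j).trans (norm_le_pi_norm _ i)
    rw [hDx t ht, mul_assoc]
    exact h2.trans (h1.trans (mul_le_mul_of_nonneg_left (hx t ht).2.2 K.2))
  obtain ⟨Qe, hQe, hQe', hQQe⟩ := exists_asymptotic_frame hl (hskew De.2.1)
    (fun t _ => (hQ t).1) (fun t _ => (hQ t).2) hΩlim
  -- The initial value is immaterial, since only relative positions are compared with the steady
  -- motion.
  obtain ⟨ce, -, hce⟩ := exists_hasDerivAt_eq (continuous_act (Q := Qe)
    (fun i j => continuous_iff_continuousAt.2 fun t => (hQe' t i j).continuousAt)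
    (continuous_const (y := De.1))) (0 : Space m)
  -- At an equilibrium the deformation rate vanishes, so the body-frame velocities are those of a
  -- rigid motion.
  have hwe : ∀ i, xe.2 i = De.1 + act (hat De.2.1) (slice G pd xe.1 i) := fun i => by
    have h1 : De.2.2 = 0 := congrArg Prod.fst hFxe
    have h2 := sliceVelocity_decomposition (hinv _ (hfst _ hxe)) xe.2 i
    rw [← hDe, h1, map_zero, Pi.zero_apply, add_zero] at h2
    exact h2.symm
  have hblim : Tendsto (fun t => slice G pd (x t).1) atTop (𝓝 (slice G pd xe.1)) :=
    ((contDiff_slice G pd (k := 0)).continuous.tendsto _).comp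
      ((continuous_fst.tendsto _).comp hxlim)
  refine ⟨fun t i => c t + act (Q t) (slice G pd (x t).1 i), fun t i => act (Q t) ((x t).2 i),
    ⟨⟨fun t ht => (hrec t ht).1.hasDerivWithinAt, fun t ht => (hrec t ht).2.hasDerivWithinAt⟩,
      by simp only [hc0, hQ0], by simp only [hQ0]⟩, ?_, slice G pd xe.1, hat De.2.1, De.1,
    fun t i => ce t + act (Qe t) (slice G pd xe.1 i),
    fun t i => act (Qe t) (De.1 + act (hat De.2.1) (slice G pd xe.1 i)),
    hrig _ (hfst _ hxe), rfl, ⟨?_, hskew _, Qe, ce, fun t => ⟨hQe t, hQe' t, hce t,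
      fun i => ⟨rfl, rfl⟩⟩⟩, fun i j => ?_, fun i => ?_⟩
  · simp only [distError_rigidMotion G pd _ (transpose_mul_of_mem (hQ _).1)]
    exact ((contDiff_distError G pd (k := 0)).continuous.tendsto _).comp hblim
  · simp only [slice, Pi.add_apply]
    rw [Finset.sum_add_distrib, hcen, sum_edgeForce, add_zero]
  · have h1 := tendsto_act_sub_act (fun t => (hQ t).1) hQQe
      (((continuous_apply i).tendsto _).comp hblim |>.sub
        (((continuous_apply j).tendsto _).comp hblim))
    refine h1.congr fun t => ?_
    simp only [Function.comp_apply, act_sub]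
    abel
  · have h1 := tendsto_act_sub_act (fun t => (hQ t).1) hQQe
      (((continuous_apply i).tendsto _).comp ((continuous_snd.tendsto _).comp hxlim))
    rw [hwe i] at h1
    exact h1

theorem eventually_isInvertible_sliceVelocity {hat : (Fin d → ℝ) →ₗ[ℝ] Matrix (Fin m) (Fin m) ℝ}
    {G : SensingGraph n r} {pd : Fin n → Space m}
    (h0 : (sliceVelocity hat G pd 0).IsInvertible) :
    ∀ᶠ y in 𝓝 0, (sliceVelocity hat G pd y).IsInvertible := by
  obtain ⟨e, he⟩ := h0
  have hc : ContinuousAt (sliceVelocity hat G pd) 0 :=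
    (contDiff_sliceVelocity hat G pd (k := 0)).continuous.continuousAt
  have := e.nhds
  rw [he] at this
  exact hc this

/-- Injectivity is an open condition, and the edge count does not depend on the positions. -/
theorem eventually_infMinRigid_slice {G : SensingGraph n r} {pd : Fin n → Space m}
    (hrigid : InfMinRigid G pd) : ∀ᶠ y in 𝓝 0, InfMinRigid G (slice G pd y) := by
  have hc : ContinuousAt (fun y => (edgeForce G).toContinuousBilinearMap (slice G pd y)) 0 :=
    ((edgeForce G).toContinuousBilinearMap.continuous.comp
      (contDiff_slice G pd (k := 0)).continuous).continuousAt
  have hopen := (ContinuousLinearMap.isOpen_injective (𝕜 := ℝ)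
    (E := EuclideanSpace ℝ (Fin r)) (F := Fin n → Space m)).mem_nhds
    (x := (edgeForce G).toContinuousBilinearMap (slice G pd 0)) (by
      rw [slice_zero]
      exact ((infMinRigid_iff G pd).1 hrigid).1)
  filter_upwards [hc hopen] with y hy
  exact (infMinRigid_iff _ _).2 ⟨hy, hrigid.2⟩

/-- The main theorem for a centred desired framework with at least one edge. -/
theorem exists_steady_motion_of_centred (hm : m = 2 ∨ m = 3) {G : SensingGraph n r}
    {pd : Fin n → Space m} (hrigid : InfMinRigid G pd) (hr : 0 < r) (hcen : ∑ i, pd i = 0) :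
    ∃ ρ : ℝ, 0 < ρ ∧ ∀ ε₂ : ℝ, 0 < ε₂ → ∃ ε₁ : ℝ, 0 < ε₁ ∧
      ∀ μ : EuclideanSpace ℝ (Fin r), ‖μ‖ ≤ ε₁ →
        ∃ eStar : EuclideanSpace ℝ (Fin r), ‖eStar‖ ≤ ε₂ ∧
          ∀ p₀ v₀ : Fin n → Space m, NearDesired G pd ρ p₀ v₀ →
            ∃ p v, (IsSolution G pd μ p v ∧ p 0 = p₀ ∧ v 0 = v₀) ∧
              ConvergesToSteadyMotion G pd eStar p v := by
  obtain ⟨d, hat, hskew, hd, hker⟩ := exists_skew_parametrization hm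
  have h0 := isInvertible_sliceVelocity_zero (velocityMap_bijective hm hskew hd hker hrigid hr)
  obtain ⟨R, hR, hRs⟩ := Metric.nhds_basis_closedBall.mem_iff.1
    ((eventually_isInvertible_sliceVelocity h0).and (eventually_infMinRigid_slice hrigid))
  have hR' : ∀ y : EuclideanSpace ℝ (Fin r), ‖y‖ ≤ R →
      (sliceVelocity hat G pd y).IsInvertible ∧ InfMinRigid G (slice G pd y) :=
    fun y hy => hRs (by simpa using hy)
  obtain ⟨B, hB, hB'⟩ := exists_lyapunov hskew ((infMinRigid_iff G pd).1 hrigid).1 h0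
  obtain ⟨ρ₁, hρ₁, hstab⟩ := exists_stable_equilibria
    ((contDiffAt_reducedField (k := 1) h0).hasStrictFDerivAt one_ne_zero)
    (reducedField_zero hat G pd) hB hB' hR
  obtain ⟨C, hC, hslice⟩ := exists_slice_representation hm hskew hd hker hrigid hr hcen
  -- This radius puts both the slice coordinate, at most `C ρ`, and the velocities, at most `ρ`,
  -- below `ρ₁`.
  refine ⟨ρ₁ / (C + 1), by positivity, fun ε₂ hε₂ => ?_⟩
  have hsmall : Tendsto (fun y => distError G pd (slice G pd y)) (𝓝 0) (𝓝 0) := by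
    have h1 : Tendsto (fun y => distError G pd (slice G pd y)) (𝓝 0)
        (𝓝 (distError G pd (slice G pd 0))) :=
      ((contDiff_distError G pd (k := 0)).continuous.comp
        (contDiff_slice G pd (k := 0)).continuous).tendsto 0
    have h2 : distError G pd (slice G pd 0) = 0 := by simp [distError_slice]
    rwa [h2] at h1
  obtain ⟨ε', hε', hε's⟩ := Metric.nhds_basis_closedBall.mem_iff.1
    (hsmall (Metric.closedBall_mem_nhds 0 hε₂))
  obtain ⟨ε₁, hε₁, hstab⟩ := hstab ε' hε'
  refine ⟨ε₁, hε₁, fun μ hμ => ?_⟩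
  obtain ⟨xe, hxe, hxeR, hFxe, C', l, hl, hsol⟩ := hstab μ hμ
  refine ⟨distError G pd (slice G pd xe.1), ?_, fun p₀ v₀ ⟨⟨Q₀, hQ₀, hp₀⟩, hv₀⟩ => ?_⟩
  · have := hε's (by simpa using (norm_fst_le xe).trans hxe : xe.1 ∈ Metric.closedBall 0 ε')
    simpa using this
  obtain ⟨Q, hQ, c, y, hy, hpy⟩ := hslice _ p₀ Q₀ hQ₀ hp₀
  let w : Fin n → Space m := fun i => act Qᵀ (v₀ i)
  have hx₀ : ‖(y, w)‖ ≤ ρ₁ := by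
    rw [Prod.norm_mk]
    refine max_le (hy.trans ?_) ((pi_norm_le_iff_of_nonneg hρ₁.le).2 fun i => ?_)
    · rw [mul_div_assoc', div_le_iff₀ (by positivity)]
      nlinarith
    · rw [norm_act (transpose_mul_of_mem (transpose_mem hQ))]
      refine (hv₀ i).trans ((div_le_iff₀ (by positivity)).2 ?_)
      nlinarith
  obtain ⟨x, hx0, hx⟩ := hsol (y, w) hx₀
  obtain ⟨p, v, ⟨hpv, hp0, hv0⟩, hconv⟩ := exists_solution_of_reduced hskew hcen hl
    (fun y hy => (hR' y hy).1) (fun y hy => (hR' y hy).2) hxeR hFxe hx hQ c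
  refine ⟨p, v, ⟨hpv, hp0.trans ?_, hv0.trans ?_⟩, hconv⟩
  · ext1 i
    rw [hx0, hpy i]
    rfl
  · ext1 i
    simp only [hx0, w]
    rw [← act_mul, mul_transpose_of_mem hQ, one_act]

end Reconstruction

/-! ### Reduction to a centred desired framework. -/

section Centring

variable {m n r : ℕ}

theorem distError_congr {G : SensingGraph n r} {pd pd' : Fin n → Space m}
    (h : relPos G pd = relPos G pd') : distError G pd = distError G pd' := by
  funext p; simp only [distError, h]

theorem rigidityMatrix_congr {G : SensingGraph n r} {pd pd' : Fin n → Space m}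
    (h : relPos G pd = relPos G pd') : rigidityMatrix G pd = rigidityMatrix G pd' := by
  unfold rigidityMatrix; rw [h]

theorem control_congr {G : SensingGraph n r} {pd pd' : Fin n → Space m}
    (h : relPos G pd = relPos G pd') : control G pd = control G pd' := by
  funext μ p v; rw [control_eq, control_eq, distError_congr h]

/-- The desired framework enters only through its relative positions, so its centroid can be moved
to the origin. -/
theorem exists_steady_motion (hm : m = 2 ∨ m = 3) {G : SensingGraph n r}
    {pd : Fin n → Space m} (hrigid : InfMinRigid G pd) (hr : 0 < r) :
    ∃ ρ : ℝ, 0 < ρ ∧ ∀ ε₂ : ℝ, 0 < ε₂ → ∃ ε₁ : ℝ, 0 < ε₁ ∧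
      ∀ μ : EuclideanSpace ℝ (Fin r), ‖μ‖ ≤ ε₁ →
        ∃ eStar : EuclideanSpace ℝ (Fin r), ‖eStar‖ ≤ ε₂ ∧
          ∀ p₀ v₀ : Fin n → Space m, NearDesired G pd ρ p₀ v₀ →
            ∃ p v, (IsSolution G pd μ p v ∧ p 0 = p₀ ∧ v 0 = v₀) ∧
              ConvergesToSteadyMotion G pd eStar p v := by
  let pc : Fin n → Space m := fun i => pd i - (n : ℝ)⁻¹ • ∑ j, pd j
  have hrel : relPos G pc = relPos G pd := by
    funext k; simp [relPos, pc]
  have hn : (n : ℝ) ≠ 0 := by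
    have : n ≠ 0 := by
      rintro rfl
      exact (G.tail ⟨0, hr⟩).elim0
    exact_mod_cast this
  have hcen : ∑ i, pc i = 0 := by
    simp only [pc]
    rw [Finset.sum_sub_distrib, Finset.sum_const, Finset.card_univ, Fintype.card_fin,
      ← Nat.cast_smul_eq_nsmul ℝ, smul_smul, mul_inv_cancel₀ hn, one_smul, sub_self]
  have hrigid' : InfMinRigid G pc := by
    unfold InfMinRigid InfinitesimallyRigid at *
    rwa [rigidityMatrix_congr hrel]
  obtain ⟨ρ, hρ, h⟩ := exists_steady_motion_of_centred hm hrigid' hr hcen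
  refine ⟨ρ, hρ, fun ε₂ hε₂ => ?_⟩
  obtain ⟨ε₁, hε₁, h⟩ := h ε₂ hε₂
  refine ⟨ε₁, hε₁, fun μ hμ => ?_⟩
  obtain ⟨eStar, he, h⟩ := h μ hμ
  refine ⟨eStar, he, fun p₀ v₀ hnear => ?_⟩
  obtain ⟨p, v, ⟨⟨hpos, hvel⟩, hp, hv⟩, hconv⟩ := h p₀ v₀ (by
    unfold NearDesired at *
    rwa [hrel])
  refine ⟨p, v, ⟨⟨hpos, ?_⟩, hp, hv⟩, ?_⟩
  · rwa [control_congr hrel] at hvel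
  · unfold ConvergesToSteadyMotion at *
    rwa [distError_congr hrel] at hconv

end Centring

end FormationProof

theorem theorem1 (m n r : ℕ) (hm : m = 2 ∨ m = 3) (hn : 2 ≤ n)
    (G : Formation.SensingGraph n r) (pd : Fin n → Formation.Space m)
    (hrigid : Formation.InfMinRigid G pd) :
    ∃ ρ : ℝ, 0 < ρ ∧ ∀ ε₂ : ℝ, 0 < ε₂ → ∃ ε₁ : ℝ, 0 < ε₁ ∧
      ∀ μ : EuclideanSpace ℝ (Fin r), ‖μ‖ ≤ ε₁ →
        ∃ eStar : EuclideanSpace ℝ (Fin r), ‖eStar‖ ≤ ε₂ ∧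
          ∀ p₀ v₀ : Fin n → Formation.Space m, Formation.NearDesired G pd ρ p₀ v₀ →
            (∃ p v : ℝ → Fin n → Formation.Space m,
              Formation.IsSolution G pd μ p v ∧ p 0 = p₀ ∧ v 0 = v₀) ∧
            ∀ p v : ℝ → Fin n → Formation.Space m,
              Formation.IsSolution G pd μ p v → p 0 = p₀ → v 0 = v₀ →
                Tendsto (fun t => Formation.distError G pd (p t)) atTop (𝓝 eStar) ∧
                ∃ (b : Fin n → Formation.Space m) (Ω : Matrix (Fin m) (Fin m) ℝ)
                  (vc : Formation.Space m) (pStar vStar : ℝ → Fin n → Formation.Space m),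
                  Formation.InfMinRigid G b ∧
                  Formation.distError G pd b = eStar ∧
                  Formation.IsSteadyMotion b Ω vc pStar vStar ∧
                  (∀ i j, Tendsto (fun t => (p t i - p t j) - (pStar t i - pStar t j))
                    atTop (𝓝 0)) ∧
                  ∀ i, Tendsto (fun t => v t i - vStar t i) atTop (𝓝 0) := by
  rcases Nat.eq_zero_or_pos r with rfl | hr
  · exact ⟨1, one_pos, fun ε₂ hε₂ => ⟨1, one_pos, fun μ _ => ⟨0, by simpa using hε₂.le,
      fun p₀ v₀ _ => FormationProof.forall_solution_of_exists
        (FormationProof.exists_solution_of_no_edges hrigid (by omega) μ p₀ v₀)⟩⟩⟩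
  · obtain ⟨ρ, hρ, h⟩ := FormationProof.exists_steady_motion hm hrigid hr
    refine ⟨ρ, hρ, fun ε₂ hε₂ => ?_⟩
    obtain ⟨ε₁, hε₁, h⟩ := h ε₂ hε₂
    refine ⟨ε₁, hε₁, fun μ hμ => ?_⟩
    obtain ⟨eStar, he, h⟩ := h μ hμ
    exact ⟨eStar, he, fun p₀ v₀ hnear =>
      FormationProof.forall_solution_of_exists (h p₀ v₀ hnear)⟩
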